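/- Let $\varphi:[0,1]\to[0,1]$ be an increasing concave function with $\varphi(0)=0$, $\varphi(1)=1$, continuous on $(0,1]$ (a jump at $0$ is allowed), and let $1\le q<\infty$. Let $\Lambda(\varphi)$ be the Lorentz space on $[0,1]$ with norm $\|f\|_{\Lambda(\varphi)}=\int_0^1 f^*(t)\,d\varphi(t)$, where $f^*$ is the decreasing rearrangement of $|f|$ (if $\varphi(0+)>0$, the integral includes the term $\varphi(0+)\|f\|_{L_\infty}$). For an $n\times n$ real matrix $x=(x_{ij})$, $n\ge 1$, let $x_1^*\ge x_2^*\ge\dots\ge x_{n^2}^*$ be the decreasing rearrangement of the numbers $|x_{ij}|$, put $$Ux(t)=\sum_{k=1}^n x_k^*\,\chi_{((k-1)/n,\,k/n)}(t),\qquad t\in[0,1],$$ and, having fixed for each $n$ a bijection $\ell$ of the symmetric group $S_n$ onto $\{1,\dots,n!\}$, put $$T_qx(t)=\Bigl(\sum_{i=1}^n|x_{i,\pi(i)}|^q\Bigr)^{1/q},\qquad t\in\Bigl[\tfrac{\ell(\pi)-1}{n!},\tfrac{\ell(\pi)}{n!}\Bigr).$$ Let $\|T_q\|_{\Lambda(\varphi)}\in[0,\infty]$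 be the least $C$ such that $\|T_qy\|_{\Lambda(\varphi)}\le C\|Uy\|_{\Lambda(\varphi)}$ for all diagonal matrices $y$ of all sizes $n\ge1$, and let $$\Gamma_{\varphi,q}=\sup_{0<t\le1}\frac1{\varphi(t)}\sum_{j=1}^\infty j^{1/q-1}\,\varphi\!\left(\frac{t^j}{j!}\right)\in[0,\infty].$$ Then there exist constants $c,C>0$, independent of $n$ and $x$, such that for all $n\ge1$ and all real $n\times n$ matrices $x$ $$c\,\Bigl(\|Ux\|_{\Lambda(\varphi)}+\Bigl(\frac1n\sum_{k=n+1}^{n^2}(x_k^*)^q\Bigr)^{1/q}\Bigr)\le\|T_qx\|_{\Lambda(\varphi)}\le C\,\Bigl(\|Ux\|_{\Lambda(\varphi)}+\Bigl(\frac1n\sum_{k=n+1}^{n^2}(x_k^*)^q\Bigr)^{1/q}\Bigr)$$ if and only if $\Gamma_{\varphi,q}<\infty$. Moreover, in $[0,\infty]$, $$\|T_q\|_{\Lambda(\varphi)}\le\Gamma_{\varphi,q}\le q\,e\,\|T_q\|_{\Lambda(\varphi)}.$$ -/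

import Mathlib

open MeasureTheory Set
open scoped ENNReal NNReal

noncomputable section

/-- The class `Φ`: increasing concave functions `φ : [0,1] → [0,1]` with `φ 0 = 0`, `φ 1 = 1`,
continuous on `(0,1]` (a jump at `0` is allowed).  Only the values on `[0,1]` matter. -/
structure PhiClass where
  toFun : ℝ → ℝ
  monotoneOn' : MonotoneOn toFun (Icc 0 1)
  concaveOn' : ConcaveOn ℝ (Icc 0 1) toFun
  continuousOn' : ContinuousOn toFun (Ioc 0 1)
  map_zero' : toFun 0 = 0
  map_one' : toFun 1 = 1

instance : CoeFun PhiClass (fun _ => ℝ → ℝ) := ⟨PhiClass.toFun⟩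

/-- `φ` extended to the line by `0` on `(-∞,0)` and by `1` on `(1,∞)`. -/
def PhiClass.extend (φ : PhiClass) (t : ℝ) : ℝ := φ (max 0 (min t 1))

theorem PhiClass.monotone_extend (φ : PhiClass) : Monotone φ.extend := by
  intro s t h
  have hs : ∀ u : ℝ, max 0 (min u 1) ∈ Icc (0 : ℝ) 1 := fun u =>
    ⟨le_max_left _ _, max_le zero_le_one (min_le_right _ _)⟩
  exact φ.monotoneOn' (hs s) (hs t) (max_le_max le_rfl (min_le_min h le_rfl))

/-- The Lebesgue-Stieltjes measure `dφ` on `[0,1]`; its mass at the point `0` is the jump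
`φ(0+) - φ(0) = φ(0+)`. -/
def PhiClass.stieltjesMeasure (φ : PhiClass) : Measure ℝ :=
  φ.monotone_extend.stieltjesFunction.measure

/-- The decreasing rearrangement `f^*(t) = inf {s ≥ 0 : mes {u ∈ [0,1] : |f u| > s} ≤ t}` of a
function `f` on `[0,1]`. -/
def decrRearrangement (f : ℝ → ℝ) (t : ℝ) : ℝ≥0∞ :=
  sInf {s : ℝ≥0∞ | volume {u : ℝ | u ∈ Icc (0 : ℝ) 1 ∧ s < ‖f u‖ₑ} ≤ ENNReal.ofReal t}

/-- The norm `‖f‖_{Λ(φ)} = ∫_0^1 f^*(t) dφ(t)` of the Lorentz space `Λ(φ)`, with values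
in `[0,∞]`. -/
def lorentzNorm (φ : PhiClass) (f : ℝ → ℝ) : ℝ≥0∞ :=
  ∫⁻ t in Icc (0 : ℝ) 1, decrRearrangement f t ∂φ.stieltjesMeasure

/-- `x_k^*`, `1 ≤ k ≤ n ^ 2`: the `k`-th largest of the numbers `|x_{ij}|`, counted with
multiplicity. -/
def entryRearrangement {n : ℕ} (x : Matrix (Fin n) (Fin n) ℝ) (k : ℕ) : ℝ :=
  (((Finset.univ : Finset (Fin n × Fin n)).val.map (fun p => |x p.1 p.2|)).sort
    (fun a b => a ≥ b)).getD (k - 1) 0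

/-- `U x = ∑_{k=1}^n x_k^* χ_{((k-1)/n, k/n)}`. -/
def opU {n : ℕ} (x : Matrix (Fin n) (Fin n) ℝ) (t : ℝ) : ℝ :=
  ∑ k ∈ Finset.Icc 1 n,
    (Ioo (((k : ℝ) - 1) / n) ((k : ℝ) / n)).indicator (fun _ => entryRearrangement x k) t

/-- `T_q x`, the step function equal to `(∑_i |x_{i,π(i)}|^q)^{1/q}` on the interval
`[(ℓ(π) - 1)/n!, ℓ(π)/n!)`, where `ℓ` is an enumeration of `S_n`; here `ℓ` takes the values
`0, …, n! - 1` instead of `1, …, n!`. -/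
def opT (q : ℝ) {n : ℕ} (ℓ : Equiv.Perm (Fin n) ≃ Fin n.factorial)
    (x : Matrix (Fin n) (Fin n) ℝ) (t : ℝ) : ℝ :=
  ∑ π : Equiv.Perm (Fin n),
    (Ico (((ℓ π : ℕ) : ℝ) / n.factorial) ((((ℓ π : ℕ) : ℝ) + 1) / n.factorial)).indicator
      (fun _ => (∑ i, |x i (π i)| ^ q) ^ (1 / q)) t

/-- The tail term `((1/n) ∑_{k=n+1}^{n^2} (x_k^*)^q)^{1/q}`. -/
def tailTerm (q : ℝ) {n : ℕ} (x : Matrix (Fin n) (Fin n) ℝ) : ℝ :=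
  ((1 / (n : ℝ)) * ∑ k ∈ Finset.Icc (n + 1) (n ^ 2), entryRearrangement x k ^ q) ^ (1 / q)

/-- The equivalence `‖T_q x‖ ≈ ‖U x‖ + ((1/n) ∑_{k=n+1}^{n^2} (x_k^*)^q)^{1/q}` in `Λ(φ)`, with
constants that depend neither on the matrix `x` nor on its size `n`. -/
def EquivalenceHolds (φ : PhiClass) (q : ℝ)
    (ℓ : ∀ n : ℕ, Equiv.Perm (Fin n) ≃ Fin n.factorial) : Prop :=
  ∃ c C : ℝ≥0, 0 < c ∧ 0 < C ∧ ∀ n : ℕ, 0 < n → ∀ x : Matrix (Fin n) (Fin n) ℝ,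
    (c : ℝ≥0∞) * (lorentzNorm φ (opU x) + ENNReal.ofReal (tailTerm q x))
        ≤ lorentzNorm φ (opT q (ℓ n) x) ∧
      lorentzNorm φ (opT q (ℓ n) x)
        ≤ (C : ℝ≥0∞) * (lorentzNorm φ (opU x) + ENNReal.ofReal (tailTerm q x))

/-- `‖T_q‖_{Λ(φ)}`: the least `C ∈ [0,∞]` such that `‖T_q y‖ ≤ C ‖U y‖` in `Λ(φ)` for every
diagonal matrix `y` of any size (`∞` if no finite constant will do). -/
def opTNorm (φ : PhiClass) (q : ℝ)
    (ℓ : ∀ n : ℕ, Equiv.Perm (Fin n) ≃ Fin n.factorial) : ℝ≥0∞ :=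
  sInf {C : ℝ≥0∞ | ∀ n : ℕ, 0 < n → ∀ y : Fin n → ℝ,
    lorentzNorm φ (opT q (ℓ n) (Matrix.diagonal y))
      ≤ C * lorentzNorm φ (opU (Matrix.diagonal y))}

/-- `Γ_{φ,q} = sup_{0<t≤1} φ(t)⁻¹ ∑_{j≥1} j^{1/q-1} φ(t^j / j!)`, with values in `[0,∞]`. -/
def gammaConst (φ : PhiClass) (q : ℝ) : ℝ≥0∞ :=
  ⨆ t ∈ Ioc (0 : ℝ) 1, ENNReal.ofReal (1 / φ t) *
    ∑' j : ℕ+, ENNReal.ofReal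
      (((j : ℕ) : ℝ) ^ (1 / q - 1) * φ (t ^ (j : ℕ) / ((j : ℕ).factorial : ℝ)))

end

open Filter Topology in
theorem PhiClass.stieltjesMeasure_Ico (φ : PhiClass) {d : ℝ} (hd : d ∈ Icc (0 : ℝ) 1) :
    φ.stieltjesMeasure (Ico 0 d) = ENNReal.ofReal (φ d) := by
  rcases hd.1.eq_or_lt with rfl | hpos
  · simp [φ.map_zero']
  have hcoe : (φ.monotone_extend.stieltjesFunction : ℝ → ℝ) = Function.rightLim φ.extend := by
    ext x; exact φ.monotone_extend.stieltjesFunction_eq x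
  rw [PhiClass.stieltjesMeasure, StieltjesFunction.measure_Ico, hcoe]
  have h0 : Function.leftLim (Function.rightLim φ.extend) 0 = 0 := by
    rw [leftLim_rightLim]
    · refine leftLim_eq_of_tendsto ?_
      refine tendsto_const_nhds.congr' ?_
      filter_upwards [self_mem_nhdsWithin] with x hx
      have hx : x < 0 := hx
      have : max 0 (min x 1) = 0 := max_eq_left ((min_le_left _ _).trans hx.le)
      simp [PhiClass.extend, this, φ.map_zero']
    · exact φ.monotone_extend.tendsto_leftLim 0
  have h1 : Function.leftLim (Function.rightLim φ.extend) d = φ d := by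
    rw [leftLim_rightLim]
    · refine leftLim_eq_of_tendsto ?_
      have hc := φ.continuousOn' d ⟨hpos, hd.2⟩
      have hc' : Tendsto φ (𝓝[<] d) (𝓝 (φ d)) := by
        refine hc.mono_left ?_
        rw [← nhdsWithin_Ioo_eq_nhdsLT hpos]
        exact nhdsWithin_mono _ fun x hx => ⟨hx.1, hx.2.le.trans hd.2⟩
      refine hc'.congr' ?_
      filter_upwards [Ioo_mem_nhdsLT hpos] with x hx
      have : max 0 (min x 1) = x := by
        rw [min_eq_left (hx.2.le.trans hd.2), max_eq_right hx.1.le]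
      simp [PhiClass.extend, this]
    · exact φ.monotone_extend.tendsto_leftLim d
  rw [h0, h1, sub_zero]

theorem antitone_decrRearrangement (f : ℝ → ℝ) : Antitone (decrRearrangement f) := by
  intro s t hst
  refine sInf_le_sInf fun r hr => ?_
  exact le_trans hr (ENNReal.ofReal_le_ofReal hst)

theorem decrRearrangement_le_ofReal {f : ℝ → ℝ} {B : ℝ} (hB : ∀ u, |f u| ≤ B) (t : ℝ) :
    decrRearrangement f t ≤ ENNReal.ofReal B := by
  refine sInf_le ?_
  have : {u : ℝ | u ∈ Icc (0 : ℝ) 1 ∧ ENNReal.ofReal B < ‖f u‖ₑ} = ∅ := by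
    ext u
    simp only [mem_ofPred_eq, mem_empty_iff_false, iff_false, not_and, not_lt]
    intro _
    rw [← ofReal_norm]
    exact ENNReal.ofReal_le_ofReal (hB u)
  simp only [mem_ofPred_eq, this, measure_empty, zero_le]

open Filter Topology in
/-- The decreasing rearrangement exceeds `s` at `t` iff the distribution function exceeds `t`
at `s`. -/
theorem lt_decrRearrangement_iff {f : ℝ → ℝ} {s : ℝ≥0∞} {t : ℝ} (hs : s ≠ ⊤) :
    s < decrRearrangement f t ↔
      ENNReal.ofReal t < volume {u : ℝ | u ∈ Icc (0 : ℝ) 1 ∧ s < ‖f u‖ₑ} := by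
  rw [← not_le, ← not_le, not_iff_not]
  refine ⟨fun h => ?_, fun h => sInf_le h⟩
  obtain ⟨v, hv, hvs, hlim⟩ := exists_seq_strictAnti_tendsto' (lt_top_iff_ne_top.2 hs)
  have hU : {u : ℝ | u ∈ Icc (0 : ℝ) 1 ∧ s < ‖f u‖ₑ}
      = ⋃ n, {u : ℝ | u ∈ Icc (0 : ℝ) 1 ∧ v n < ‖f u‖ₑ} := by
    ext u
    simp only [mem_ofPred_eq, mem_iUnion]
    refine ⟨fun hu => ?_, fun ⟨n, hn⟩ => ⟨hn.1, (hvs n).1.trans hn.2⟩⟩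
    obtain ⟨n, hn⟩ := (hlim.eventually (gt_mem_nhds hu.2)).exists
    exact ⟨n, hu.1, hn⟩
  have hmono : Monotone fun n => {u : ℝ | u ∈ Icc (0 : ℝ) 1 ∧ v n < ‖f u‖ₑ} :=
    fun m n hmn u hu => ⟨hu.1, (hv.antitone hmn).trans_lt hu.2⟩
  rw [hU, hmono.measure_iUnion]
  refine iSup_le fun n => ?_
  obtain ⟨r, hr, hrn⟩ := sInf_lt_iff.1 (h.trans_lt (hvs n).1)
  have hr : volume {u : ℝ | u ∈ Icc (0 : ℝ) 1 ∧ r < ‖f u‖ₑ} ≤ ENNReal.ofReal t := hr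
  refine le_trans (measure_mono ?_) hr
  exact fun u hu => ⟨hu.1, hrn.trans hu.2⟩

/-- Layer-cake formula for the Lorentz norm of a bounded function. -/
theorem lorentzNorm_eq_lintegral_distribution (φ : PhiClass) {f : ℝ → ℝ} {B : ℝ}
    (hB : ∀ u, |f u| ≤ B) :
    lorentzNorm φ f = ∫⁻ s in Ioi (0 : ℝ), ENNReal.ofReal
      (φ (volume {u : ℝ | u ∈ Icc (0 : ℝ) 1 ∧ s < |f u|}).toReal) := by
  have hfin : ∀ t, decrRearrangement f t ≠ ⊤ := fun t =>
    ((decrRearrangement_le_ofReal hB t).trans_lt ENNReal.ofReal_lt_top).ne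
  have hanti : Antitone fun t => (decrRearrangement f t).toReal := fun s t hst =>
    ENNReal.toReal_mono (hfin s) (antitone_decrRearrangement f hst)
  have h1 : lorentzNorm φ f = ∫⁻ t in Icc (0 : ℝ) 1,
      ENNReal.ofReal (decrRearrangement f t).toReal ∂φ.stieltjesMeasure := by
    refine lintegral_congr fun t => ?_
    rw [ENNReal.ofReal_toReal (hfin t)]
  rw [h1, lintegral_eq_lintegral_meas_lt _ (ae_of_all _ fun t => ENNReal.toReal_nonneg)
    hanti.measurable.aemeasurable]
  refine setLIntegral_congr_fun measurableSet_Ioi fun s hs => ?_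
  have hs : 0 < s := hs
  set D := volume {u : ℝ | u ∈ Icc (0 : ℝ) 1 ∧ s < |f u|} with hD
  have hD1 : D ≤ 1 := by
    calc D ≤ volume (Icc (0 : ℝ) 1) := measure_mono fun u hu => hu.1
      _ = 1 := by simp
  have hDfin : D ≠ ⊤ := (hD1.trans_lt ENNReal.one_lt_top).ne
  have hd1 : D.toReal ≤ 1 := by
    simpa using ENNReal.toReal_mono ENNReal.one_ne_top hD1
  have hD' : volume {u : ℝ | u ∈ Icc (0 : ℝ) 1 ∧ ENNReal.ofReal s < ‖f u‖ₑ} = D := by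
    rw [hD]
    congr 1
    ext u
    simp only [mem_ofPred_eq]
    rw [← ofReal_norm, ENNReal.ofReal_lt_ofReal_iff_of_nonneg hs.le, Real.norm_eq_abs]
  rw [Measure.restrict_apply (measurableSet_lt measurable_const hanti.measurable),
    ← φ.stieltjesMeasure_Ico ⟨ENNReal.toReal_nonneg, hd1⟩]
  congr 1
  ext t
  simp only [mem_inter_iff, mem_ofPred_eq, mem_Icc, mem_Ico]
  have key : 0 ≤ t → (s < (decrRearrangement f t).toReal ↔ t < D.toReal) := fun ht => by
    rw [← ENNReal.ofReal_lt_iff_lt_toReal hs.le (hfin t),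
      ← ENNReal.ofReal_lt_iff_lt_toReal ht hDfin, ← hD']
    exact lt_decrRearrangement_iff ENNReal.ofReal_ne_top
  exact ⟨fun h => ⟨h.2.1, (key h.2.1).1 h.1⟩,
    fun h => ⟨(key h.1).2 h.2, h.1, h.2.le.trans hd1⟩⟩

namespace PhiClass

variable (φ : PhiClass)

theorem mono {s t : ℝ} (hs : 0 ≤ s) (hst : s ≤ t) (ht : t ≤ 1) : φ s ≤ φ t :=
  φ.monotoneOn' ⟨hs, hst.trans ht⟩ ⟨hs.trans hst, ht⟩ hst

theorem nonneg {t : ℝ} (h0 : 0 ≤ t) (h1 : t ≤ 1) : 0 ≤ φ t := by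
  simpa [φ.map_zero'] using φ.mono le_rfl h0 h1

theorem mul_le {c t : ℝ} (hc0 : 0 ≤ c) (hc1 : c ≤ 1) (h0 : 0 ≤ t) (h1 : t ≤ 1) :
    c * φ t ≤ φ (c * t) := by
  have := φ.concaveOn'.2 (x := t) ⟨h0, h1⟩ (y := 0) ⟨le_rfl, zero_le_one⟩ hc0
    (sub_nonneg.2 hc1) (by ring)
  simpa [φ.map_zero'] using this

theorem le_self {t : ℝ} (h0 : 0 ≤ t) (h1 : t ≤ 1) : t ≤ φ t := by
  simpa [φ.map_one'] using φ.mul_le h0 h1 zero_le_one le_rfl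

theorem pos {t : ℝ} (h0 : 0 < t) (h1 : t ≤ 1) : 0 < φ t := h0.trans_le (φ.le_self h0.le h1)

/-- The increment of `φ` over the `r`-th interval of the uniform partition into `N` parts. -/
noncomputable def increment (N r : ℕ) : ℝ := φ ((r + 1 : ℕ) / N) - φ ((r : ℝ) / N)

theorem increment_nonneg {N r : ℕ} (hr : r < N) : 0 ≤ φ.increment N r := by
  have hN : (0 : ℝ) < N := by exact_mod_cast (Nat.zero_le r).trans_lt hr
  have h1 : ((r + 1 : ℕ) : ℝ) ≤ N := by exact_mod_cast hr
  refine sub_nonneg.2 (φ.mono (by positivity) ?_ ((div_le_one hN).2 h1))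
  gcongr
  simp

theorem increment_antitone {N r s : ℕ} (hrs : r ≤ s) (hs : s < N) :
    φ.increment N s ≤ φ.increment N r := by
  induction s, hrs using Nat.le_induction with
  | base => exact le_rfl
  | succ s hrs ih =>
    refine le_trans ?_ (ih (by omega))
    have hN : (0 : ℝ) < N := by exact_mod_cast (Nat.zero_le _).trans_lt hs
    have h2 : ((s + 1 + 1 : ℕ) : ℝ) ≤ N := by exact_mod_cast hs
    have h2' : (s : ℝ) + 2 ≤ N := by push_cast at h2; linarith
    have hx : (s : ℝ) / N ∈ Icc (0 : ℝ) 1 := ⟨by positivity, (div_le_one hN).2 (by linarith)⟩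
    have hy : ((s + 1 + 1 : ℕ) : ℝ) / N ∈ Icc (0 : ℝ) 1 :=
      ⟨by positivity, (div_le_one hN).2 h2⟩
    have hconc := φ.concaveOn'.2
    have := hconc hx hy (a := 1 / 2) (b := 1 / 2) (by norm_num) (by norm_num) (by norm_num)
    have he : (1 / 2 : ℝ) • ((s : ℝ) / N) + (1 / 2 : ℝ) • (((s + 1 + 1 : ℕ) : ℝ) / N)
        = ((s + 1 : ℕ) : ℝ) / N := by
      push_cast [smul_eq_mul]; ring
    rw [he] at this
    simp only [smul_eq_mul] at this
    unfold increment
    linarith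

theorem sum_range_increment {N k : ℕ} :
    ∑ r ∈ Finset.range k, φ.increment N r = φ ((k : ℝ) / N) := by
  have := Finset.sum_range_sub (fun r : ℕ => φ ((r : ℝ) / N)) k
  simpa [increment, φ.map_zero'] using this

theorem sum_increment_le {N : ℕ} (S : Finset ℕ) (hS : ∀ r ∈ S, r < N) :
    ∑ r ∈ S, φ.increment N r ≤ φ ((S.card : ℝ) / N) := by
  induction S using Finset.induction_on_max with
  | empty => simp [φ.map_zero']
  | insert a S ha ih =>
    have hn : a ∉ S := fun h => lt_irrefl _ (ha a h)
    have hcard : S.card ≤ a := by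
      have : S ⊆ Finset.range a := fun x hx => Finset.mem_range.2 (ha x hx)
      simpa using Finset.card_le_card this
    have haN : a < N := hS a (Finset.mem_insert_self _ _)
    rw [Finset.sum_insert hn, Finset.card_insert_of_notMem hn]
    have h1 := ih fun r hr => hS r (Finset.mem_insert_of_mem hr)
    have h2 := φ.increment_antitone hcard haN
    have h3 : φ.increment N S.card = φ ((S.card + 1 : ℕ) / N) - φ ((S.card : ℝ) / N) := rfl
    linarith

end PhiClass

theorem Finset.eq_range_card_of_forall_lt_mem {S : Finset ℕ}
    (h : ∀ x ∈ S, ∀ y < x, y ∈ S) : S = Finset.range S.card := by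
  refine Finset.eq_of_subset_of_card_le (fun x hx => ?_) (by simp)
  have : Finset.range (x + 1) ⊆ S := fun y hy => by
    rcases (Nat.lt_succ_iff.1 (Finset.mem_range.1 hy)).eq_or_lt with rfl | hlt
    · exact hx
    · exact h x hx y hlt
  have := Finset.card_le_card this
  rw [Finset.card_range] at this
  exact Finset.mem_range.2 this

section Finite

variable {Ω : Type*} [Fintype Ω]

/-- The proportion of points of a finite set where `g` exceeds `s`. -/
noncomputable def tailProb (g : Ω → ℝ) (s : ℝ) : ℝ :=
  ((Finset.univ.filter fun ω => s < g ω).card : ℝ) / Fintype.card Ω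

theorem tailProb_nonneg (g : Ω → ℝ) (s : ℝ) : 0 ≤ tailProb g s := by
  unfold tailProb; positivity

theorem tailProb_le_one (g : Ω → ℝ) (s : ℝ) : tailProb g s ≤ 1 :=
  div_le_one_of_le₀ (by exact_mod_cast Finset.card_filter_le _ _) (by positivity)

theorem tailProb_le_tailProb {g h : Ω → ℝ} {s t : ℝ} (H : ∀ ω, s < g ω → t < h ω) :
    tailProb g s ≤ tailProb h t := by
  unfold tailProb
  have := Finset.card_le_card (Finset.monotone_filter_right (Finset.univ : Finset Ω)
    (p := fun ω => s < g ω) (q := fun ω => t < h ω) fun ω _ => H ω)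
  gcongr

/-- The Lorentz norm of a nonnegative function on a finite set with the uniform probability. -/
noncomputable def levelNorm (φ : PhiClass) (g : Ω → ℝ) : ℝ≥0∞ :=
  ∫⁻ s in Ioi (0 : ℝ), ENNReal.ofReal (φ (tailProb g s))

theorem levelNorm_mono (φ : PhiClass) {g h : Ω → ℝ} (H : ∀ ω, g ω ≤ h ω) :
    levelNorm φ g ≤ levelNorm φ h := by
  refine lintegral_mono fun s => ENNReal.ofReal_le_ofReal ?_
  exact φ.mono (tailProb_nonneg _ _) (tailProb_le_tailProb fun ω hω => hω.trans_le (H ω))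
    (tailProb_le_one _ _)

/-- The value at `g` of the linear functional whose weights are the increments of `φ`, assigned
to the points of `Ω` in the order `e`. -/
noncomputable def orderedSum (φ : PhiClass) (e : Fin (Fintype.card Ω) ≃ Ω) (g : Ω → ℝ) : ℝ≥0∞ :=
  ∑ r : Fin (Fintype.card Ω), ENNReal.ofReal (φ.increment (Fintype.card Ω) r) *
    ENNReal.ofReal (g (e r))

theorem lintegral_ite_lt (x : ℝ) :
    ∫⁻ s in Ioi (0 : ℝ), (if s < x then 1 else 0 : ℝ≥0∞) = ENNReal.ofReal x := by
  have : (fun s : ℝ => (if s < x then 1 else 0 : ℝ≥0∞)) = (Iio x).indicator 1 := by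
    ext s; simp [indicator_apply]
  rw [this, lintegral_indicator_one measurableSet_Iio, Measure.restrict_apply measurableSet_Iio,
    Iio_inter_Ioi, Real.volume_Ioo, sub_zero]

theorem measurable_ite_lt (x : ℝ) : Measurable fun s : ℝ => (if s < x then 1 else 0 : ℝ≥0∞) :=
  Measurable.ite measurableSet_Iio measurable_const measurable_const

theorem orderedSum_eq_lintegral (φ : PhiClass) (e : Fin (Fintype.card Ω) ≃ Ω) (g : Ω → ℝ) :
    orderedSum φ e g = ∫⁻ s in Ioi (0 : ℝ), ENNReal.ofReal
      (∑ r ∈ (Finset.univ.filter fun r => s < g (e r)).map Fin.valEmbedding,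
        φ.increment (Fintype.card Ω) r) := by
  unfold orderedSum
  simp_rw [← lintegral_ite_lt (g _), ← lintegral_const_mul _ (measurable_ite_lt _)]
  rw [← lintegral_finsetSum _ fun r _ => (measurable_ite_lt _).const_mul _]
  refine lintegral_congr fun s => ?_
  rw [Finset.sum_map, ENNReal.ofReal_sum_of_nonneg, Finset.sum_filter]
  · refine Finset.sum_congr rfl fun r _ => ?_
    split_ifs <;> simp
  · exact fun r _ => φ.increment_nonneg r.2

theorem card_filter_comp_equiv (e : Fin (Fintype.card Ω) ≃ Ω) (g : Ω → ℝ) (s : ℝ) :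
    ((Finset.univ.filter fun r => s < g (e r)).map Fin.valEmbedding).card
      = (Finset.univ.filter fun ω => s < g ω).card := by
  rw [Finset.card_map]
  exact Finset.card_equiv e (by simp)

theorem orderedSum_le_levelNorm (φ : PhiClass) (e : Fin (Fintype.card Ω) ≃ Ω) (g : Ω → ℝ) :
    orderedSum φ e g ≤ levelNorm φ g := by
  rw [orderedSum_eq_lintegral]
  refine lintegral_mono fun s => ENNReal.ofReal_le_ofReal ?_
  refine (φ.sum_increment_le _ ?_).trans_eq ?_
  · intro r hr
    obtain ⟨r, -, rfl⟩ := Finset.mem_map.1 hr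
    exact r.2
  · rw [card_filter_comp_equiv]; rfl

theorem orderedSum_eq_levelNorm (φ : PhiClass) {e : Fin (Fintype.card Ω) ≃ Ω} {g : Ω → ℝ}
    (h : Antitone (g ∘ e)) : orderedSum φ e g = levelNorm φ g := by
  rw [orderedSum_eq_lintegral]
  refine lintegral_congr fun s => ?_
  rw [Finset.eq_range_card_of_forall_lt_mem (S := Finset.map _ _) ?_,
    PhiClass.sum_range_increment, card_filter_comp_equiv]
  · rfl
  · intro x hx y hy
    obtain ⟨r, hr, rfl⟩ := Finset.mem_map.1 hx
    have hy : y < r := hy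
    refine Finset.mem_map.2 ⟨⟨y, hy.trans r.2⟩, ?_, rfl⟩
    simp only [Finset.mem_filter, Finset.mem_univ, true_and] at hr ⊢
    exact hr.trans_le (h (show (⟨y, hy.trans r.2⟩ : Fin _) ≤ r from hy.le))

theorem exists_antitone_comp_equiv (g : Ω → ℝ) :
    ∃ e : Fin (Fintype.card Ω) ≃ Ω, Antitone (g ∘ e) := by
  let e₀ := (Fintype.equivFin Ω).symm
  refine ⟨(Tuple.sort fun i => - g (e₀ i)).trans e₀, fun i j hij => ?_⟩
  have := Tuple.monotone_sort (fun i => - g (e₀ i)) hij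
  simpa using this

theorem levelNorm_add_le (φ : PhiClass) (g h : Ω → ℝ) :
    levelNorm φ (g + h) ≤ levelNorm φ g + levelNorm φ h := by
  obtain ⟨e, he⟩ := exists_antitone_comp_equiv (g + h)
  rw [← orderedSum_eq_levelNorm φ he]
  refine le_trans ?_ (add_le_add (orderedSum_le_levelNorm φ e g) (orderedSum_le_levelNorm φ e h))
  rw [orderedSum, orderedSum, orderedSum, ← Finset.sum_add_distrib]
  refine Finset.sum_le_sum fun r _ => ?_
  rw [← mul_add]
  gcongr
  exact ENNReal.ofReal_add_le

theorem levelNorm_zero (φ : PhiClass) : levelNorm φ (fun _ : Ω => 0) = 0 := by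
  rw [levelNorm, setLIntegral_congr_fun (g := fun _ => 0) measurableSet_Ioi]
  · simp
  · intro s hs
    have hs : 0 < s := hs
    simp [tailProb, hs.le.not_gt, φ.map_zero']

theorem levelNorm_sum_le (φ : PhiClass) {ι : Type*} (S : Finset ι) (g : ι → Ω → ℝ) :
    levelNorm φ (fun ω => ∑ i ∈ S, g i ω) ≤ ∑ i ∈ S, levelNorm φ (g i) := by
  classical
  induction S using Finset.induction_on with
  | empty => simp [levelNorm_zero]
  | insert i S hi ih =>
    simp_rw [Finset.sum_insert hi]
    exact (levelNorm_add_le φ (g i) _).trans (by gcongr)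

theorem levelNorm_const_mul (φ : PhiClass) {c : ℝ} (hc : 0 ≤ c) (g : Ω → ℝ) :
    levelNorm φ (fun ω => c * g ω) = ENNReal.ofReal c * levelNorm φ g := by
  obtain ⟨e, he⟩ := exists_antitone_comp_equiv g
  have he' : Antitone ((fun ω => c * g ω) ∘ e) := fun i j hij =>
    mul_le_mul_of_nonneg_left (he hij) hc
  rw [← orderedSum_eq_levelNorm φ he, ← orderedSum_eq_levelNorm φ he', orderedSum, orderedSum,
    Finset.mul_sum]
  refine Finset.sum_congr rfl fun r _ => ?_
  rw [ENNReal.ofReal_mul hc]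
  ring

theorem levelNorm_indicator (φ : PhiClass) (g : Ω → ℝ) (u : ℝ) :
    levelNorm φ (fun ω => if u < g ω then 1 else 0) = ENNReal.ofReal (φ (tailProb g u)) := by
  have : ∀ s ∈ Ioi (0 : ℝ), ENNReal.ofReal (φ (tailProb (fun ω => if u < g ω then 1 else 0) s))
      = ENNReal.ofReal (φ (tailProb g u)) * (if s < 1 then 1 else 0) := by
    intro s hs
    have hs : 0 < s := hs
    by_cases h1 : s < 1
    · have : tailProb (fun ω => if u < g ω then (1 : ℝ) else 0) s = tailProb g u := by
        unfold tailProb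
        congr 3
        ext ω
        simp only [Finset.mem_filter, Finset.mem_univ, true_and]
        split_ifs with h <;> simp [h, h1, hs.le]
      rw [this, if_pos h1, mul_one]
    · have : tailProb (fun ω => if u < g ω then (1 : ℝ) else 0) s = 0 := by
        unfold tailProb
        rw [Finset.filter_false_of_mem, Finset.card_empty]
        · simp
        · intro ω _
          dsimp only
          split_ifs <;> linarith
      rw [this, if_neg h1, φ.map_zero']
      simp
  rw [levelNorm, setLIntegral_congr_fun measurableSet_Ioi this,
    lintegral_const_mul _ (measurable_ite_lt _), lintegral_ite_lt]
  simp

/-- The norm `levelNorm` is additive on functions that are antitone along a common order. -/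
theorem levelNorm_ge_sum_indicator (φ : PhiClass) {ι : Type*} (S : Finset ι) (Y g : Ω → ℝ)
    (c u : ι → ℝ) (hc : ∀ i ∈ S, 0 ≤ c i)
    (hg : ∀ ω, ∑ i ∈ S, c i * (if u i < Y ω then 1 else 0) ≤ g ω) :
    ∑ i ∈ S, ENNReal.ofReal (c i) * ENNReal.ofReal (φ (tailProb Y (u i))) ≤ levelNorm φ g := by
  obtain ⟨e, he⟩ := exists_antitone_comp_equiv Y
  refine le_trans (b := ∑ r : Fin (Fintype.card Ω), ENNReal.ofReal (φ.increment (Fintype.card Ω) r) *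
      ENNReal.ofReal (∑ i ∈ S, c i * (if u i < Y (e r) then 1 else 0)))
    (le_of_eq ?_) (orderedSum_le_levelNorm φ e g |>.trans' ?_)
  · have h1 : ∀ r, ENNReal.ofReal (∑ i ∈ S, c i * (if u i < Y (e r) then 1 else 0))
        = ∑ i ∈ S, ENNReal.ofReal (c i) * ENNReal.ofReal (if u i < Y (e r) then 1 else 0) := by
      intro r
      rw [ENNReal.ofReal_sum_of_nonneg]
      · exact Finset.sum_congr rfl fun i hi => ENNReal.ofReal_mul (hc i hi)
      · intro i hi
        have := hc i hi
        positivity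
    simp_rw [h1, Finset.mul_sum]
    rw [Finset.sum_comm]
    refine Finset.sum_congr rfl fun i _ => ?_
    rw [← levelNorm_indicator, ← orderedSum_eq_levelNorm φ (e := e), orderedSum, Finset.mul_sum]
    · exact Finset.sum_congr rfl fun r _ => by ring
    · intro r s hrs
      have := he hrs
      simp only [Function.comp_apply] at this ⊢
      split_ifs with h1 h2
      · exact le_rfl
      · exact absurd (h1.trans_le this) h2
      · exact zero_le_one
      · exact le_rfl
  · unfold orderedSum
    gcongr
    exact hg _

end Finite

theorem tsum_le_gammaConst_mul (φ : PhiClass) (q : ℝ) {t : ℝ} (ht : t ∈ Ioc (0 : ℝ) 1) :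
    ∑' j : ℕ+, ENNReal.ofReal
      (((j : ℕ) : ℝ) ^ (1 / q - 1) * φ (t ^ (j : ℕ) / ((j : ℕ).factorial : ℝ)))
      ≤ gammaConst φ q * ENNReal.ofReal (φ t) := by
  have hp := φ.pos ht.1 ht.2
  have h : ENNReal.ofReal (1 / φ t) * ∑' j : ℕ+, ENNReal.ofReal
      (((j : ℕ) : ℝ) ^ (1 / q - 1) * φ (t ^ (j : ℕ) / ((j : ℕ).factorial : ℝ)))
      ≤ gammaConst φ q := le_iSup₂_of_le t ht le_rfl
  have h2 : ENNReal.ofReal (φ t) * ENNReal.ofReal (1 / φ t) = 1 := by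
    rw [← ENNReal.ofReal_mul hp.le, mul_one_div_cancel hp.ne', ENNReal.ofReal_one]
  calc _ = ENNReal.ofReal (φ t) * (ENNReal.ofReal (1 / φ t) * _) := by
        rw [← mul_assoc, h2, one_mul]
    _ ≤ ENNReal.ofReal (φ t) * gammaConst φ q := by gcongr
    _ = _ := mul_comm _ _

theorem rpow_succ_sub_rpow_le {a : ℝ} (ha1 : a ≤ 1) (v : ℕ) :
    ((v + 1 : ℕ) : ℝ) ^ a - (v : ℝ) ^ a ≤ ((v + 1 : ℕ) : ℝ) ^ (a - 1) := by
  have hv : (0 : ℝ) < ((v + 1 : ℕ) : ℝ) := by positivity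
  have h1 : (v : ℝ) = ((v + 1 : ℕ) : ℝ) * (v / ((v + 1 : ℕ) : ℝ)) := by field_simp
  have hx0 : (0 : ℝ) ≤ v / ((v + 1 : ℕ) : ℝ) := by positivity
  have hx1 : (v : ℝ) / ((v + 1 : ℕ) : ℝ) ≤ 1 := by
    rw [div_le_one hv]; simp
  have h2 : (v : ℝ) / ((v + 1 : ℕ) : ℝ) ≤ (v / ((v + 1 : ℕ) : ℝ)) ^ a :=
    Real.self_le_rpow_of_le_one hx0 hx1 ha1
  have h3 : (v : ℝ) ^ a = ((v + 1 : ℕ) : ℝ) ^ a * (v / ((v + 1 : ℕ) : ℝ)) ^ a := by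
    rw [← Real.mul_rpow hv.le hx0, ← h1]
  rw [h3, Real.rpow_sub_one hv.ne']
  have h4 : (1 : ℝ) - v / ((v + 1 : ℕ) : ℝ) = 1 / ((v + 1 : ℕ) : ℝ) := by
    field_simp; push_cast; ring
  have hp : 0 ≤ ((v + 1 : ℕ) : ℝ) ^ a := by positivity
  calc _ = ((v + 1 : ℕ) : ℝ) ^ a * (1 - (v / ((v + 1 : ℕ) : ℝ)) ^ a) := by ring
    _ ≤ ((v + 1 : ℕ) : ℝ) ^ a * (1 - v / ((v + 1 : ℕ) : ℝ)) := by gcongr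
    _ = _ := by rw [h4]; ring

theorem mul_rpow_sub_one_le_sub {a : ℝ} (ha0 : 0 ≤ a) (ha1 : a ≤ 1) (v : ℕ) :
    a * ((v + 1 : ℕ) : ℝ) ^ (a - 1) ≤ ((v + 1 : ℕ) : ℝ) ^ a - (v : ℝ) ^ a := by
  have hv : (0 : ℝ) < ((v + 1 : ℕ) : ℝ) := by positivity
  have h1 : (v : ℝ) = ((v + 1 : ℕ) : ℝ) * (1 + - (1 / ((v + 1 : ℕ) : ℝ))) := by
    field_simp; push_cast; ring
  have hx1 : (-1 : ℝ) ≤ -(1 / ((v + 1 : ℕ) : ℝ)) := by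
    rw [neg_le_neg_iff, div_le_one hv]; simp
  have h2 := rpow_one_add_le_one_add_mul_self hx1 ha0 ha1
  have h3 : (v : ℝ) ^ a = ((v + 1 : ℕ) : ℝ) ^ a * (1 + - (1 / ((v + 1 : ℕ) : ℝ))) ^ a := by
    rw [← Real.mul_rpow hv.le (by linarith), ← h1]
  rw [h3, Real.rpow_sub_one hv.ne']
  have hp : 0 ≤ ((v + 1 : ℕ) : ℝ) ^ a := by positivity
  have := mul_le_mul_of_nonneg_left h2 hp
  have e : a * (((v + 1 : ℕ) : ℝ) ^ a / ((v + 1 : ℕ) : ℝ)) = ((v + 1 : ℕ) : ℝ) ^ a -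
    ((v + 1 : ℕ) : ℝ) ^ a * (1 + a * -(1 / ((v + 1 : ℕ) : ℝ))) := by ring
  linarith

/-- If the tails of `Z` at the points `K v` are dominated by `t ^ (v + 1) / (v + 1)!`, then
the norm of `Z ^ (1 / q)` is controlled by `gammaConst`. -/
theorem levelNorm_rpow_le_gammaConst (φ : PhiClass) {q : ℝ} (hq : 1 ≤ q) {Ω : Type*} [Fintype Ω]
    {Z : Ω → ℝ} (hZ : ∀ ω, 0 ≤ Z ω) {K t : ℝ} (hK : 0 < K) (ht : t ∈ Ioc (0 : ℝ) 1)
    (htail : ∀ v : ℕ, tailProb Z (K * v) ≤ t ^ (v + 1) / ((v + 1).factorial : ℝ)) :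
    levelNorm φ (fun ω => Z ω ^ (1 / q)) ≤
      ENNReal.ofReal (K ^ (1 / q)) * (gammaConst φ q * ENNReal.ofReal (φ t)) := by
  have ha0 : 0 ≤ 1 / q := by positivity
  have ha1 : 1 / q ≤ 1 := by rw [div_le_one (by linarith)]; exact hq
  set a := 1 / q with ha
  have hapos : 0 < a := by rw [ha]; positivity
  obtain ⟨V, hV⟩ : ∃ V : ℕ, ∀ ω, Z ω ≤ K * V := by
    obtain ⟨B, hB⟩ := (Set.finite_range Z).bddAbove
    refine ⟨⌈B / K⌉₊, fun ω => (hB ⟨ω, rfl⟩).trans ?_⟩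
    have := Nat.le_ceil (B / K)
    rw [div_le_iff₀ hK] at this
    linarith
  have hδ : ∀ v : ℕ, 0 ≤ ((v + 1 : ℕ) : ℝ) ^ a - (v : ℝ) ^ a := fun v =>
    sub_nonneg.2 (by gcongr; simp)
  have hpt : ∀ ω, Z ω ^ a ≤ K ^ a * ∑ v ∈ Finset.range V,
      (((v + 1 : ℕ) : ℝ) ^ a - (v : ℝ) ^ a) * (if K * v < Z ω then 1 else 0) := by
    intro ω
    set k := ⌈Z ω / K⌉₊ with hk
    have hkV : k ≤ V := Nat.ceil_le.2 ((div_le_iff₀ hK).2 (by linarith [hV ω]))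
    have h1 : Z ω ≤ K * k := by
      have := Nat.le_ceil (Z ω / K)
      rw [div_le_iff₀ hK] at this
      linarith
    have h2 : (k : ℝ) ^ a ≤ ∑ v ∈ Finset.range V,
        (((v + 1 : ℕ) : ℝ) ^ a - (v : ℝ) ^ a) * (if K * v < Z ω then 1 else 0) := by
      calc (k : ℝ) ^ a = ∑ v ∈ Finset.range k, (((v + 1 : ℕ) : ℝ) ^ a - (v : ℝ) ^ a) := by
            rw [Finset.sum_range_sub (fun v : ℕ => (v : ℝ) ^ a)]
            simp [Real.zero_rpow hapos.ne']
        _ = ∑ v ∈ Finset.range k,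
            (((v + 1 : ℕ) : ℝ) ^ a - (v : ℝ) ^ a) * (if K * v < Z ω then 1 else 0) := by
            refine Finset.sum_congr rfl fun v hv => ?_
            have := Nat.lt_ceil.1 (Finset.mem_range.1 hv)
            rw [lt_div_iff₀ hK, mul_comm] at this
            rw [if_pos this, mul_one]
        _ ≤ _ := by
            refine Finset.sum_le_sum_of_subset_of_nonneg
              (Finset.range_subset_range.2 hkV) fun v _ _ => ?_
            have := hδ v
            positivity
    calc Z ω ^ a ≤ (K * k) ^ a := by gcongr; exact hZ ω
      _ = K ^ a * (k : ℝ) ^ a := Real.mul_rpow hK.le (by positivity)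
      _ ≤ _ := by gcongr
  have hKa : 0 ≤ K ^ a := by positivity
  refine (levelNorm_mono φ hpt).trans ?_
  rw [levelNorm_const_mul φ hKa]
  gcongr
  refine (levelNorm_sum_le φ _ _).trans ?_
  refine le_trans ?_ (tsum_le_gammaConst_mul φ q ht)
  rw [← Equiv.pnatEquivNat.symm.tsum_eq]
  refine le_trans ?_ (ENNReal.sum_le_tsum (Finset.range V))
  refine Finset.sum_le_sum fun v _ => ?_
  rw [levelNorm_const_mul φ (hδ v), levelNorm_indicator, ← ENNReal.ofReal_mul (hδ v)]
  refine ENNReal.ofReal_le_ofReal ?_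
  have hle1 : t ^ (v + 1) / ((v + 1).factorial : ℝ) ≤ 1 := by
    refine div_le_one_of_le₀ ((pow_le_one₀ ht.1.le ht.2).trans ?_) (by positivity)
    exact_mod_cast Nat.factorial_pos _
  have h1 := φ.mono (tailProb_nonneg _ _) (htail v) hle1
  have h2 := rpow_succ_sub_rpow_le ha1 v
  have h3 := φ.nonneg (tailProb_nonneg Z (K * v)) (tailProb_le_one _ _)
  simp only [Equiv.pnatEquivNat_symm_apply, Nat.succPNat_coe, Nat.succ_eq_add_one]
  exact mul_le_mul h2 h1 h3 (by positivity)

section StepFunction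

variable {ι : Type*} {T : Finset ι} {S : ι → Set ℝ} {c : ι → ℝ}

theorem volume_lt_abs_step (hS : ∀ i ∈ T, MeasurableSet (S i))
    (hdisj : (T : Set ι).PairwiseDisjoint S) (hsub : ∀ i ∈ T, S i ⊆ Icc 0 1)
    (hc : ∀ i ∈ T, 0 ≤ c i) {s : ℝ} (hs : 0 < s) :
    volume {u : ℝ | u ∈ Icc (0 : ℝ) 1 ∧ s < |∑ i ∈ T, (S i).indicator (fun _ => c i) u|}
      = ∑ i ∈ T.filter fun i => s < c i, volume (S i) := by
  have hval : ∀ i ∈ T, ∀ u ∈ S i, ∑ j ∈ T, (S j).indicator (fun _ => c j) u = c i := by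
    intro i hi u hu
    rw [Finset.sum_eq_single_of_mem i hi, indicator_of_mem hu]
    intro j hj hji
    refine indicator_of_notMem (fun huj => ?_) _
    exact Set.disjoint_left.1 (hdisj hj hi hji) huj hu
  have : {u : ℝ | u ∈ Icc (0 : ℝ) 1 ∧ s < |∑ i ∈ T, (S i).indicator (fun _ => c i) u|}
      = ⋃ i ∈ T.filter fun i => s < c i, S i := by
    ext u
    simp only [mem_ofPred_eq, mem_iUnion, Finset.mem_filter, exists_prop]
    constructor
    · rintro ⟨-, h⟩
      by_cases hu : ∃ i ∈ T, u ∈ S i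
      · obtain ⟨i, hi, hui⟩ := hu
        rw [hval i hi u hui, abs_of_nonneg (hc i hi)] at h
        exact ⟨i, ⟨hi, h⟩, hui⟩
      · push Not at hu
        rw [Finset.sum_eq_zero fun i hi => indicator_of_notMem (hu i hi) _, abs_zero] at h
        exact absurd h hs.le.not_gt
    · rintro ⟨i, ⟨hi, h⟩, hui⟩
      refine ⟨hsub i hi hui, ?_⟩
      rwa [hval i hi u hui, abs_of_nonneg (hc i hi)]
  rw [this, measure_biUnion_finset]
  · intro i hi j hj hij
    exact hdisj (Finset.mem_filter.1 hi).1 (Finset.mem_filter.1 hj).1 hij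
  · exact fun i hi => hS i (Finset.mem_filter.1 hi).1

theorem lorentzNorm_step (φ : PhiClass) (hS : ∀ i ∈ T, MeasurableSet (S i))
    (hdisj : (T : Set ι).PairwiseDisjoint S) (hsub : ∀ i ∈ T, S i ⊆ Icc 0 1)
    (hc : ∀ i ∈ T, 0 ≤ c i) {N : ℕ} (hvol : ∀ i ∈ T, volume (S i) = ENNReal.ofReal (1 / N)) :
    lorentzNorm φ (fun u => ∑ i ∈ T, (S i).indicator (fun _ => c i) u)
      = ∫⁻ s in Ioi (0 : ℝ), ENNReal.ofReal (φ ((T.filter fun i => s < c i).card / N)) := by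
  rw [lorentzNorm_eq_lintegral_distribution φ (B := ∑ i ∈ T, c i)]
  · refine setLIntegral_congr_fun measurableSet_Ioi fun s hs => ?_
    rw [volume_lt_abs_step hS hdisj hsub hc hs,
      Finset.sum_congr rfl fun i hi => hvol i (Finset.mem_filter.1 hi).1, Finset.sum_const,
      nsmul_eq_mul, ENNReal.toReal_mul, ENNReal.toReal_natCast,
      ENNReal.toReal_ofReal (by positivity), mul_one_div]
  · intro u
    refine (Finset.abs_sum_le_sum_abs _ _).trans (Finset.sum_le_sum fun i hi => ?_)
    by_cases hu : u ∈ S i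
    · rw [indicator_of_mem hu, abs_of_nonneg (hc i hi)]
    · rw [indicator_of_notMem hu, abs_zero]; exact hc i hi

end StepFunction

/-- The function of a random permutation that `opT` spreads over `[0,1]`. -/
noncomputable def diagonalNorm (q : ℝ) {n : ℕ} (x : Matrix (Fin n) (Fin n) ℝ)
    (π : Equiv.Perm (Fin n)) : ℝ :=
  (∑ i, |x i (π i)| ^ q) ^ (1 / q)

theorem diagonalNorm_nonneg (q : ℝ) {n : ℕ} (x : Matrix (Fin n) (Fin n) ℝ)
    (π : Equiv.Perm (Fin n)) : 0 ≤ diagonalNorm q x π := by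
  unfold diagonalNorm; positivity

theorem lorentzNorm_opT (φ : PhiClass) (q : ℝ) {n : ℕ}
    (ℓ : Equiv.Perm (Fin n) ≃ Fin n.factorial) (x : Matrix (Fin n) (Fin n) ℝ) :
    lorentzNorm φ (opT q ℓ x) = levelNorm φ (diagonalNorm q x) := by
  have hpos : (0 : ℝ) < n.factorial := by exact_mod_cast n.factorial_pos
  refine (lorentzNorm_step φ (c := diagonalNorm q x) (N := n.factorial)
    (fun _ _ => measurableSet_Ico) ?_ ?_ (fun π _ => diagonalNorm_nonneg q x π) ?_).trans ?_
  · intro π _ σ _ hne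
    refine Set.disjoint_left.2 fun u hu hv => hne ?_
    obtain ⟨h1, h2⟩ := hu
    obtain ⟨h3, h4⟩ := hv
    have h5 : ((ℓ π : ℕ) : ℝ) < (ℓ σ : ℕ) + 1 :=
      (div_lt_div_iff_of_pos_right hpos).1 (h1.trans_lt h4)
    have h6 : ((ℓ σ : ℕ) : ℝ) < (ℓ π : ℕ) + 1 :=
      (div_lt_div_iff_of_pos_right hpos).1 (h3.trans_lt h2)
    have h5' : (ℓ π : ℕ) < (ℓ σ : ℕ) + 1 := by exact_mod_cast h5
    have h6' : (ℓ σ : ℕ) < (ℓ π : ℕ) + 1 := by exact_mod_cast h6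
    exact ℓ.injective (Fin.ext (by omega))
  · intro π _ u hu
    have h1 : ((ℓ π : ℕ) : ℝ) + 1 ≤ n.factorial := by exact_mod_cast (ℓ π).2
    exact ⟨le_trans (by positivity) hu.1, hu.2.le.trans ((div_le_one hpos).2 h1)⟩
  · intro π _
    rw [Real.volume_Ico]
    congr 1
    ring
  · refine lintegral_congr fun s => ?_
    simp only [tailProb, Fintype.card_perm, Fintype.card_fin]

section EntryRearrangement

variable {n : ℕ} (x : Matrix (Fin n) (Fin n) ℝ)

theorem sum_entries_eq_sum_rearrangement {M : Type*} [AddCommMonoid M] (g : ℝ → M) :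
    ∑ p : Fin n × Fin n, g |x p.1 p.2|
      = ∑ k ∈ Finset.Icc 1 (n ^ 2), g (entryRearrangement x k) := by
  unfold entryRearrangement
  set m := (Finset.univ : Finset (Fin n × Fin n)).val.map (fun p => |x p.1 p.2|) with hm
  set l := m.sort (fun a b => a ≥ b) with hl
  have hlen : l.length = n ^ 2 := by
    rw [hl, Multiset.length_sort, hm, Multiset.card_map]
    simp [sq]
  have h1 : ∑ p : Fin n × Fin n, g |x p.1 p.2| = (l.map g).sum := by
    have : (m.map g).sum = (l.map g).sum := by
      rw [← Multiset.sort_eq m (fun a b => a ≥ b), Multiset.map_coe, Multiset.sum_coe]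
    rw [← this, hm, Multiset.map_map]
    rfl
  have h2 : ∑ k ∈ Finset.Icc 1 (n ^ 2), g (l.getD (k - 1) 0)
      = ∑ k ∈ Finset.range (n ^ 2), g (l.getD k 0) := by
    rw [Finset.range_eq_Ico]
    exact (Finset.sum_Ico_add' (fun k => g (l.getD (k - 1) 0)) 0 (n ^ 2) 1).symm
  rw [h1, h2, ← hlen, Finset.sum_range, ← Fin.sum_univ_fun_getElem]
  refine Finset.sum_congr rfl fun i _ => ?_
  rw [List.getD_eq_getElem _ _ i.2]

theorem entryRearrangement_nonneg (k : ℕ) : 0 ≤ entryRearrangement x k := by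
  unfold entryRearrangement
  rw [List.getD_eq_getElem?_getD]
  rcases h : (Multiset.sort _ (fun a b : ℝ => a ≥ b))[k - 1]? with _ | a
  · simp
  · have := List.mem_of_getElem? h
    rw [Multiset.mem_sort, Multiset.mem_map] at this
    obtain ⟨p, -, rfl⟩ := this
    simp

theorem entryRearrangement_antitone {j k : ℕ} (hjk : j ≤ k) :
    entryRearrangement x k ≤ entryRearrangement x j := by
  have h0 := entryRearrangement_nonneg x j
  unfold entryRearrangement at h0 ⊢
  set m := (Finset.univ : Finset (Fin n × Fin n)).val.map (fun p => |x p.1 p.2|) with hm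
  set l := m.sort (fun a b => a ≥ b) with hl
  by_cases hk : k - 1 < l.length
  · rw [List.getD_eq_getElem _ _ hk, List.getD_eq_getElem _ _ (by omega)]
    rcases (show j - 1 ≤ k - 1 by omega).eq_or_lt with h | h
    · simp [h]
    · exact List.pairwise_iff_getElem.1 (Multiset.pairwise_sort m (fun a b => a ≥ b)) _ _ _ _ h
  · rw [List.getD_eq_default _ _ (by omega)]
    exact h0

theorem card_rearrangement_gt (s : ℝ) :
    ((Finset.Icc 1 n).filter fun k => s < entryRearrangement x k).card
      = min n (Finset.univ.filter fun p : Fin n × Fin n => s < |x p.1 p.2|).card := by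
  have h1 : (Finset.univ.filter fun p : Fin n × Fin n => s < |x p.1 p.2|).card
      = ((Finset.Icc 1 (n ^ 2)).filter fun k => s < entryRearrangement x k).card := by
    have := sum_entries_eq_sum_rearrangement x (fun a => if s < a then 1 else 0)
    rw [Finset.card_filter, Finset.card_filter]
    exact this
  rw [h1]
  have hn : n ≤ n ^ 2 := Nat.le_self_pow two_ne_zero n
  have hsub : ((Finset.Icc 1 n).filter fun k => s < entryRearrangement x k)
      ⊆ (Finset.Icc 1 (n ^ 2)).filter fun k => s < entryRearrangement x k :=
    Finset.filter_subset_filter _ (Finset.Icc_subset_Icc_right hn)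
  by_cases h : ∃ k ∈ Finset.Icc (n + 1) (n ^ 2), s < entryRearrangement x k
  · obtain ⟨k, hk, hsk⟩ := h
    rw [Finset.mem_Icc] at hk
    have : ((Finset.Icc 1 n).filter fun k => s < entryRearrangement x k) = Finset.Icc 1 n := by
      refine Finset.filter_true_of_mem fun j hj => hsk.trans_le ?_
      exact entryRearrangement_antitone x ((Finset.mem_Icc.1 hj).2.trans (by omega))
    rw [this] at hsub ⊢
    have := Finset.card_le_card hsub
    rw [Nat.card_Icc, Nat.add_sub_cancel] at this ⊢
    exact (min_eq_left this).symm
  · push Not at h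
    have : ((Finset.Icc 1 (n ^ 2)).filter fun k => s < entryRearrangement x k)
        = (Finset.Icc 1 n).filter fun k => s < entryRearrangement x k := by
      ext k
      simp only [Finset.mem_filter, Finset.mem_Icc] at h ⊢
      constructor
      · rintro ⟨⟨h1, h2⟩, h3⟩
        refine ⟨⟨h1, ?_⟩, h3⟩
        by_contra hk
        exact absurd h3 (h k ⟨by omega, h2⟩).not_gt
      · rintro ⟨⟨h1, h2⟩, h3⟩
        exact ⟨⟨h1, h2.trans hn⟩, h3⟩
    rw [this, min_eq_right]
    refine (Finset.card_filter_le _ _).trans ?_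
    simp

theorem lorentzNorm_opU (φ : PhiClass) :
    lorentzNorm φ (opU x) = ∫⁻ s in Ioi (0 : ℝ), ENNReal.ofReal
      (φ ((min n (Finset.univ.filter fun p : Fin n × Fin n => s < |x p.1 p.2|).card : ℕ) / n)) := by
  simp_rw [← card_rearrangement_gt]
  refine lorentzNorm_step φ (fun _ _ => measurableSet_Ioo) ?_ ?_
    (fun k _ => entryRearrangement_nonneg x k) ?_
  · intro j hj k hk hne
    have hn : (0 : ℝ) < n := by
      have := Finset.mem_Icc.1 hj
      exact_mod_cast (by omega : 0 < n)
    refine Set.disjoint_left.2 fun u hu hv => hne ?_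
    obtain ⟨h1, h2⟩ := hu
    obtain ⟨h3, h4⟩ := hv
    have h5 := (div_lt_div_iff_of_pos_right hn).1 (h1.trans h4)
    have h6 := (div_lt_div_iff_of_pos_right hn).1 (h3.trans h2)
    have h5' : j < k + 1 := by
      have : (j : ℝ) < k + 1 := by linarith
      exact_mod_cast this
    have h6' : k < j + 1 := by
      have : (k : ℝ) < j + 1 := by linarith
      exact_mod_cast this
    omega
  · intro k hk u hu
    obtain ⟨hk1, hkn⟩ := Finset.mem_Icc.1 hk
    have hn : (0 : ℝ) < n := by exact_mod_cast (by omega : 0 < n)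
    have h1 : (1 : ℝ) ≤ k := by exact_mod_cast hk1
    have h2 : (k : ℝ) ≤ n := by exact_mod_cast hkn
    exact ⟨(div_nonneg (by linarith) hn.le).trans hu.1.le,
      hu.2.le.trans ((div_le_one hn).2 h2)⟩
  · intro k _
    rw [Real.volume_Ioo]
    congr 1
    ring

theorem ofReal_entryRearrangement_le_lorentzNorm_opU (φ : PhiClass) (hn : 0 < n) :
    ENNReal.ofReal (entryRearrangement x n) ≤ lorentzNorm φ (opU x) := by
  rw [lorentzNorm_opU, ← lintegral_ite_lt]
  refine lintegral_mono fun s => ?_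
  dsimp only
  split_ifs with h
  · have : ((Finset.Icc 1 n).filter fun k => s < entryRearrangement x k) = Finset.Icc 1 n :=
      Finset.filter_true_of_mem fun j hj =>
        h.trans_le (entryRearrangement_antitone x (Finset.mem_Icc.1 hj).2)
    have hn' : (n : ℝ) ≠ 0 := by exact_mod_cast hn.ne'
    rw [← card_rearrangement_gt, this, Nat.card_Icc, Nat.add_sub_cancel, div_self hn', φ.map_one']
    simp
  · exact zero_le

theorem card_gt_entryRearrangement_lt (hn : 0 < n) :
    (Finset.univ.filter fun p : Fin n × Fin n => entryRearrangement x n < |x p.1 p.2|).card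
      < n := by
  have h := card_rearrangement_gt x (entryRearrangement x n)
  have : ((Finset.Icc 1 n).filter fun k => entryRearrangement x n < entryRearrangement x k)
      ⊂ Finset.Icc 1 n :=
    Finset.filter_ssubset.2 ⟨n, Finset.mem_Icc.2 ⟨hn, le_rfl⟩, lt_irrefl _⟩
  have := Finset.card_lt_card this
  rw [h, Nat.card_Icc, Nat.add_sub_cancel] at this
  omega

theorem sum_min_rpow_eq (q : ℝ) :
    ∑ p : Fin n × Fin n, min |x p.1 p.2| (entryRearrangement x n) ^ q
      = n * entryRearrangement x n ^ q
        + ∑ k ∈ Finset.Icc (n + 1) (n ^ 2), entryRearrangement x k ^ q := by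
  rw [sum_entries_eq_sum_rearrangement x fun a => min a (entryRearrangement x n) ^ q]
  have hn : n ≤ n ^ 2 := Nat.le_self_pow two_ne_zero n
  have hun : Finset.Icc 1 (n ^ 2) = Finset.Icc 1 n ∪ Finset.Icc (n + 1) (n ^ 2) := by
    ext k; simp only [Finset.mem_union, Finset.mem_Icc]; omega
  have hdis : Disjoint (Finset.Icc 1 n) (Finset.Icc (n + 1) (n ^ 2)) := by
    rw [Finset.disjoint_left]; intro k; simp only [Finset.mem_Icc]; omega
  rw [hun, Finset.sum_union hdis]
  congr 1
  · rw [Finset.sum_congr rfl fun k hk => by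
      rw [min_eq_right (entryRearrangement_antitone x (Finset.mem_Icc.1 hk).2)]]
    simp
  · refine Finset.sum_congr rfl fun k hk => ?_
    rw [min_eq_left (entryRearrangement_antitone x (by have := Finset.mem_Icc.1 hk; omega))]

theorem tailTerm_nonneg (q : ℝ) : 0 ≤ tailTerm q x := by
  have : 0 ≤ ∑ k ∈ Finset.Icc (n + 1) (n ^ 2), entryRearrangement x k ^ q :=
    Finset.sum_nonneg fun k _ => Real.rpow_nonneg (entryRearrangement_nonneg x k) _
  unfold tailTerm
  positivity

theorem tailTerm_rpow {q : ℝ} (hq : 0 < q) :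
    tailTerm q x ^ q
      = 1 / (n : ℝ) * ∑ k ∈ Finset.Icc (n + 1) (n ^ 2), entryRearrangement x k ^ q := by
  have : 0 ≤ ∑ k ∈ Finset.Icc (n + 1) (n ^ 2), entryRearrangement x k ^ q :=
    Finset.sum_nonneg fun k _ => Real.rpow_nonneg (entryRearrangement_nonneg x k) _
  rw [tailTerm, ← Real.rpow_mul (by positivity), one_div_mul_cancel hq.ne', Real.rpow_one]

end EntryRearrangement

section Diagonal

variable {n : ℕ} (y : Fin n → ℝ)

theorem card_diagonal_gt {s : ℝ} (hs : 0 ≤ s) :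
    (Finset.univ.filter fun p : Fin n × Fin n => s < |Matrix.diagonal y p.1 p.2|).card
      = (Finset.univ.filter fun i => s < |y i|).card := by
  symm
  refine Finset.card_bij (fun i _ => (i, i)) ?_ ?_ ?_
  · intro i hi; simpa using hi
  · intro i _ j _ h; exact congrArg Prod.fst h
  · rintro ⟨i, j⟩ h
    simp only [Finset.mem_filter, Finset.mem_univ, true_and] at h ⊢
    by_cases hij : i = j
    · subst hij
      exact ⟨i, by simpa using h, rfl⟩
    · rw [Matrix.diagonal_apply_ne _ hij, abs_zero] at h
      exact absurd h hs.not_gt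

theorem lorentzNorm_opU_diagonal (φ : PhiClass) :
    lorentzNorm φ (opU (Matrix.diagonal y)) = levelNorm φ fun i => |y i| := by
  rw [lorentzNorm_opU]
  refine setLIntegral_congr_fun measurableSet_Ioi fun s hs => ?_
  rw [card_diagonal_gt y (le_of_lt hs), min_eq_right, tailProb, Fintype.card_fin]
  exact (Finset.card_filter_le _ _).trans (by simp)

theorem tailTerm_diagonal {q : ℝ} (hq : 0 < q) : tailTerm q (Matrix.diagonal y) = 0 := by
  have : ∀ k ∈ Finset.Icc (n + 1) (n ^ 2), entryRearrangement (Matrix.diagonal y) k ^ q = 0 := by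
    intro k hk
    rw [Finset.mem_Icc] at hk
    rcases (entryRearrangement_nonneg (Matrix.diagonal y) k).eq_or_lt with h | h
    · rw [← h, Real.zero_rpow hq.ne']
    · exfalso
      have h1 : (Finset.univ.filter fun p : Fin n × Fin n =>
            0 < |Matrix.diagonal y p.1 p.2|).card
          = ((Finset.Icc 1 (n ^ 2)).filter fun k =>
            0 < entryRearrangement (Matrix.diagonal y) k).card := by
        have := sum_entries_eq_sum_rearrangement (Matrix.diagonal y)
          (fun a => if 0 < a then 1 else 0)
        rw [Finset.card_filter, Finset.card_filter]
        exact this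
      rw [card_diagonal_gt y le_rfl] at h1
      have h2 : (Finset.univ.filter fun i => 0 < |y i|).card ≤ n :=
        (Finset.card_filter_le _ _).trans (by simp)
      have h3 : Finset.Icc 1 k ⊆ (Finset.Icc 1 (n ^ 2)).filter fun k =>
            0 < entryRearrangement (Matrix.diagonal y) k := by
        intro j hj
        rw [Finset.mem_Icc] at hj
        exact Finset.mem_filter.2 ⟨Finset.mem_Icc.2 ⟨hj.1, hj.2.trans hk.2⟩,
          h.trans_le (entryRearrangement_antitone _ hj.2)⟩
      have h4 := Finset.card_le_card h3
      rw [Nat.card_Icc] at h4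
      omega
  rw [tailTerm, Finset.sum_eq_zero this, mul_zero, Real.zero_rpow (one_div_pos.2 hq).ne']

end Diagonal

theorem sum_powersetCard_prod_le {ι : Type*} (S : Finset ι) {r : ι → ℝ} (hr : ∀ i, 0 ≤ r i)
    (j : ℕ) : ∑ I ∈ S.powersetCard j, ∏ i ∈ I, r i ≤ (∑ i ∈ S, r i) ^ j / (j.factorial : ℝ) := by
  classical
  induction S using Finset.induction_on generalizing j with
  | empty =>
    rcases j with _ | j
    · simp
    · rw [Finset.powersetCard_eq_empty.2 (by simp)]
      simp
  | insert a S ha ih =>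
    rcases j with _ | j
    · simp
    rw [Finset.powersetCard_succ_insert ha, Finset.sum_union, Finset.sum_image,
      Finset.sum_insert ha]
    · have h1 : ∑ I ∈ S.powersetCard j, ∏ i ∈ insert a I, r i
          = r a * ∑ I ∈ S.powersetCard j, ∏ i ∈ I, r i := by
        rw [Finset.mul_sum]
        refine Finset.sum_congr rfl fun I hI => ?_
        rw [Finset.prod_insert fun h => ha ((Finset.mem_powersetCard.1 hI).1 h)]
      rw [h1]
      have hR : 0 ≤ ∑ i ∈ S, r i := Finset.sum_nonneg fun i _ => hr i
      set R := ∑ i ∈ S, r i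
      have h2 := ih (j + 1)
      have h3 := mul_le_mul_of_nonneg_left (ih j) (hr a)
      have h4 : R ^ (j + 1) + (j + 1 : ℕ) * r a * R ^ j ≤ (r a + R) ^ (j + 1) := by
        rw [add_pow, Finset.sum_range_succ' _ (j + 1), Finset.sum_range_succ' _ j, add_comm]
        have : (0 : ℝ) ≤ ∑ k ∈ Finset.range j, r a ^ (k + 1 + 1) * R ^ (j + 1 - (k + 1 + 1)) *
            ((j + 1).choose (k + 1 + 1)) :=
          Finset.sum_nonneg fun k _ => by have := hr a; positivity
        simp only [zero_add, pow_one, Nat.add_sub_cancel, Nat.choose_one_right, pow_zero, one_mul,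
          Nat.sub_zero, Nat.choose_zero_right, Nat.cast_one, mul_one]
        linarith
      have hf : ((j + 1).factorial : ℝ) = (j + 1 : ℕ) * j.factorial := by
        rw [Nat.factorial_succ]; push_cast; ring
      have hjf : (0 : ℝ) < j.factorial := by exact_mod_cast j.factorial_pos
      have hj : (0 : ℝ) < (j + 1 : ℕ) := by positivity
      have h5 : r a * (R ^ j / j.factorial) = (j + 1 : ℕ) * r a * R ^ j / (j + 1).factorial := by
        rw [hf]; field_simp
      calc _ ≤ R ^ (j + 1) / ((j + 1).factorial : ℝ) + r a * (R ^ j / j.factorial) :=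
            add_le_add h2 h3
        _ = (R ^ (j + 1) + (j + 1 : ℕ) * r a * R ^ j) / (j + 1).factorial := by
            rw [h5, add_div]
        _ ≤ _ := by gcongr
    · intro I hI J hJ h
      have hI := fun h => ha ((Finset.mem_powersetCard.1 hI).1 h)
      have hJ := fun h => ha ((Finset.mem_powersetCard.1 hJ).1 h)
      rw [← Finset.erase_insert hI, ← Finset.erase_insert hJ, h]
    · rw [Finset.disjoint_left]
      intro I hI hI'
      obtain ⟨J, -, rfl⟩ := Finset.mem_image.1 hI'
      exact ha ((Finset.mem_powersetCard.1 hI).1 (Finset.mem_insert_self _ _))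

theorem factorial_mul_pow_le_exp_mul_factorial {n j : ℕ} (hj : j ≤ n) :
    ((n - j).factorial : ℝ) * (n : ℝ) ^ j ≤ Real.exp 1 ^ j * n.factorial := by
  induction n generalizing j with
  | zero => obtain rfl : j = 0 := by omega
            simp
  | succ n ih =>
    rcases j with _ | j
    · simp
    have ih := ih (j := j) (by omega)
    have h1 : ((n + 1 : ℕ) : ℝ) ^ j ≤ Real.exp 1 * (n : ℝ) ^ j := by
      rcases Nat.eq_zero_or_pos n with rfl | hn
      · obtain rfl : j = 0 := by omega
        simp
      have hn' : (0 : ℝ) < n := by exact_mod_cast hn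
      have h2 : ((n + 1 : ℕ) : ℝ) ≤ n * Real.exp (1 / n) := by
        have := mul_le_mul_of_nonneg_left (Real.add_one_le_exp (1 / (n : ℝ))) hn'.le
        refine le_trans (le_of_eq ?_) this
        field_simp; push_cast; ring
      calc ((n + 1 : ℕ) : ℝ) ^ j ≤ (n * Real.exp (1 / n)) ^ j := by gcongr
        _ = Real.exp (j * (1 / n)) * (n : ℝ) ^ j := by
            rw [mul_pow, ← Real.exp_nat_mul]; ring
        _ ≤ _ := by
            gcongr
            rw [mul_one_div, div_le_one hn']
            exact_mod_cast (by omega : j ≤ n)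
    have e1 : n + 1 - (j + 1) = n - j := by omega
    rw [e1, Nat.factorial_succ, pow_succ, pow_succ]
    push_cast at h1 ⊢
    calc ((n - j).factorial : ℝ) * (((n : ℝ) + 1) ^ j * (n + 1))
        ≤ ((n - j).factorial : ℝ) * ((Real.exp 1 * (n : ℝ) ^ j) * (n + 1)) := by gcongr
      _ = (((n - j).factorial : ℝ) * (n : ℝ) ^ j) * (Real.exp 1 * (n + 1)) := by ring
      _ ≤ (Real.exp 1 ^ j * n.factorial) * (Real.exp 1 * (n + 1)) := by gcongr
      _ = _ := by ring

section Perm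

variable {n : ℕ}

/-- The sum of `w` along the graph of a permutation. -/
def permSum (w : Fin n → Fin n → ℝ) (π : Equiv.Perm (Fin n)) : ℝ := ∑ i, w i (π i)

theorem card_perm_eqOn_le (I : Finset (Fin n)) (f : Fin n → Fin n) :
    (Finset.univ.filter fun π : Equiv.Perm (Fin n) => ∀ i ∈ I, π i = f i).card
      ≤ (n - I.card).factorial := by
  by_cases hne : ∃ π₀ : Equiv.Perm (Fin n), ∀ i ∈ I, π₀ i = f i
  swap
  · push Not at hne
    rw [Finset.filter_false_of_mem, Finset.card_empty]
    · exact Nat.zero_le _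
    · intro π _ h
      obtain ⟨i, hi, hi'⟩ := hne π
      exact hi' (h i hi)
  obtain ⟨π₀, h₀⟩ := hne
  have hcard : Fintype.card {σ : Equiv.Perm (Fin n) // ∀ a, ¬ (a ∉ I) → σ a = a}
      = (n - I.card).factorial := by
    rw [← Fintype.card_congr (Equiv.Perm.subtypeEquivSubtypePerm fun a => a ∉ I),
      Fintype.card_perm]
    congr 1
    rw [Fintype.card_subtype_compl, Fintype.card_fin, Fintype.card_coe]
  rw [← hcard, Fintype.card_subtype]
  refine Finset.card_le_card_of_injOn (fun π => π₀⁻¹ * π) ?_ ?_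
  · intro π hπ
    simp only [Finset.coe_filter, Finset.mem_univ, true_and, mem_ofPred_eq, not_not] at hπ ⊢
    intro a ha
    rw [Equiv.Perm.mul_apply, hπ a ha, ← h₀ a ha]
    exact π₀.symm_apply_apply a
  · intro π _ σ _ h
    exact mul_left_cancel h

theorem sum_perm_prod_le {w : Fin n → Fin n → ℝ} (hw : ∀ i j, 0 ≤ w i j) (I : Finset (Fin n)) :
    ∑ π : Equiv.Perm (Fin n), ∏ i ∈ I, w i (π i)
      ≤ ((n - I.card).factorial : ℝ) * ∏ i ∈ I, ∑ j, w i j := by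
  have h1 : ∏ i ∈ I, ∑ j, w i j = ∑ f : I → Fin n, ∏ i : I, w i (f i) := by
    rw [← Finset.prod_coe_sort, Finset.prod_univ_sum, Fintype.piFinset_univ]
  rw [h1, ← Finset.sum_fiberwise _ (fun π : Equiv.Perm (Fin n) => fun i : I => π i),
    Finset.mul_sum]
  refine Finset.sum_le_sum fun f _ => ?_
  have h2 : ∀ π ∈ Finset.univ.filter
      (fun π : Equiv.Perm (Fin n) => (fun i : I => π i) = f),
      ∏ i ∈ I, w i (π i) = ∏ i : I, w i (f i) := by
    intro π hπ
    rw [← Finset.prod_coe_sort, ← (Finset.mem_filter.1 hπ).2]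
  rw [Finset.sum_congr rfl h2, Finset.sum_const, nsmul_eq_mul]
  refine mul_le_mul_of_nonneg_right ?_ (Finset.prod_nonneg fun i _ => hw _ _)
  have h3 := card_perm_eqOn_le I fun i => if h : i ∈ I then f ⟨i, h⟩ else i
  refine le_trans ?_ (Nat.cast_le.2 h3)
  refine Nat.cast_le.2 (Finset.card_le_card fun π hπ => ?_)
  rw [Finset.mem_filter] at hπ ⊢
  refine ⟨hπ.1, fun i hi => ?_⟩
  rw [dif_pos hi, ← hπ.2]

theorem sum_perm_prod_one_add_le {w : Fin n → Fin n → ℝ} (hw : ∀ i j, 0 ≤ w i j) :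
    ∑ π : Equiv.Perm (Fin n), ∏ i, (1 + w i (π i))
      ≤ n.factorial * Real.exp (Real.exp 1 * ((∑ i, ∑ j, w i j) / n)) := by
  set R := ∑ i, ∑ j, w i j with hR
  have hR0 : 0 ≤ R := Finset.sum_nonneg fun i _ => Finset.sum_nonneg fun j _ => hw i j
  simp_rw [Finset.prod_one_add, Finset.sum_powerset]
  rw [Finset.sum_comm]
  have hx : 0 ≤ Real.exp 1 * (R / n) := by positivity
  refine le_trans ?_ (mul_le_mul_of_nonneg_left (Real.sum_le_exp_of_nonneg hx (n + 1))
    (by positivity))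
  rw [Finset.mul_sum, Finset.card_univ, Fintype.card_fin]
  refine Finset.sum_le_sum fun j hj => ?_
  have hjn : j ≤ n := Nat.lt_succ_iff.1 (Finset.mem_range.1 hj)
  rw [Finset.sum_comm]
  calc ∑ I ∈ Finset.powersetCard j Finset.univ, ∑ π : Equiv.Perm (Fin n), ∏ i ∈ I, w i (π i)
      ≤ ∑ I ∈ Finset.powersetCard j Finset.univ,
          ((n - j).factorial : ℝ) * ∏ i ∈ I, ∑ j, w i j := by
        refine Finset.sum_le_sum fun I hI => ?_
        have := sum_perm_prod_le hw I
        rwa [(Finset.mem_powersetCard.1 hI).2] at this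
    _ ≤ ((n - j).factorial : ℝ) * (R ^ j / j.factorial) := by
        rw [← Finset.mul_sum]
        gcongr
        exact sum_powersetCard_prod_le _ (fun i => Finset.sum_nonneg fun j _ => hw i j) j
    _ ≤ n.factorial * ((Real.exp 1 * (R / n)) ^ j / j.factorial) := by
        rw [← mul_div_assoc, ← mul_div_assoc]
        refine div_le_div_of_nonneg_right ?_ (by positivity)
        rcases Nat.eq_zero_or_pos n with rfl | hn
        · obtain rfl : j = 0 := by omega
          simp
        have hn' : (0 : ℝ) < n := by exact_mod_cast hn
        have := factorial_mul_pow_le_exp_mul_factorial hjn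
        rw [mul_pow, div_pow, ← mul_div_assoc, ← mul_div_assoc, le_div_iff₀ (by positivity)]
        nlinarith [mul_le_mul_of_nonneg_right this (pow_nonneg hR0 j)]

theorem sum_perm_apply (i : Fin n) (f : Fin n → ℝ) :
    n * ∑ π : Equiv.Perm (Fin n), f (π i) = n.factorial * ∑ j, f j := by
  have h : ∀ i', ∑ π : Equiv.Perm (Fin n), f (π i') = ∑ π : Equiv.Perm (Fin n), f (π i) := by
    intro i'
    rw [← Equiv.sum_comp (Equiv.mulRight (Equiv.swap i i'))]
    simp
  calc n * ∑ π : Equiv.Perm (Fin n), f (π i)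
      = ∑ i', ∑ π : Equiv.Perm (Fin n), f (π i') := by
        rw [Finset.sum_congr rfl fun i' _ => h i']; simp
    _ = ∑ π : Equiv.Perm (Fin n), ∑ j, f j := by
        rw [Finset.sum_comm]
        exact Finset.sum_congr rfl fun π _ => Equiv.sum_comp π f
    _ = _ := by simp [Fintype.card_perm]

theorem sum_permSum (hn : 0 < n) (w : Fin n → Fin n → ℝ) :
    ∑ π, permSum w π = n.factorial * ((∑ i, ∑ j, w i j) / n) := by
  have hn' : (n : ℝ) ≠ 0 := by exact_mod_cast hn.ne'
  unfold permSum
  rw [Finset.sum_comm, ← mul_div_assoc, eq_div_iff hn', mul_comm, Finset.mul_sum, Finset.mul_sum]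
  exact Finset.sum_congr rfl fun i _ => sum_perm_apply i (w i)

theorem permSum_nonneg {w : Fin n → Fin n → ℝ} (hw : ∀ i j, 0 ≤ w i j)
    (π : Equiv.Perm (Fin n)) : 0 ≤ permSum w π := Finset.sum_nonneg fun i _ => hw i _

theorem tailProb_perm (g : Equiv.Perm (Fin n) → ℝ) (s : ℝ) :
    tailProb g s = ((Finset.univ.filter fun π => s < g π).card : ℝ) / n.factorial := by
  rw [tailProb, Fintype.card_perm, Fintype.card_fin]

theorem tailProb_permSum_le_exp {w : Fin n → Fin n → ℝ} (hw0 : ∀ i j, 0 ≤ w i j)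
    (hw1 : ∀ i j, w i j ≤ 1) {s : ℝ} (hs : 0 ≤ s) (u : ℝ) :
    tailProb (permSum w) u
      ≤ (1 + s) ^ (-u) * Real.exp (Real.exp 1 * (s * ((∑ i, ∑ j, w i j) / n))) := by
  have hfac : (0 : ℝ) < n.factorial := by exact_mod_cast n.factorial_pos
  have hs1 : 0 < 1 + s := by linarith
  have h1 := sum_perm_prod_one_add_le (w := fun i j => s * w i j)
    fun i j => mul_nonneg hs (hw0 i j)
  simp_rw [← Finset.mul_sum, mul_div_assoc] at h1
  have h2 : ∀ π : Equiv.Perm (Fin n), (1 + s) ^ permSum w π ≤ ∏ i, (1 + s * w i (π i)) := by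
    intro π
    rw [permSum, Real.rpow_sum_of_pos hs1]
    refine Finset.prod_le_prod (fun i _ => by positivity) fun i _ => ?_
    rw [mul_comm s]
    exact rpow_one_add_le_one_add_mul_self (by linarith) (hw0 _ _) (hw1 _ _)
  have h3 : ((Finset.univ.filter fun π => u < permSum w π).card : ℝ) * (1 + s) ^ u
      ≤ ∑ π : Equiv.Perm (Fin n), ∏ i, (1 + s * w i (π i)) := by
    rw [← nsmul_eq_mul, ← Finset.sum_const]
    refine le_trans (Finset.sum_le_sum fun π hπ => ?_)
      (Finset.sum_le_sum_of_subset_of_nonneg (Finset.filter_subset _ _) fun π _ _ => ?_)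
    · refine le_trans ?_ (h2 π)
      exact Real.rpow_le_rpow_of_exponent_le (by linarith) (Finset.mem_filter.1 hπ).2.le
    · exact (Real.rpow_nonneg hs1.le _).trans (h2 π)
  have hp : 0 < (1 + s) ^ u := by positivity
  rw [tailProb_perm, Real.rpow_neg hs1.le, inv_mul_eq_div, div_le_div_iff₀ hfac hp]
  linarith

/-- Poisson-type tail bound for the sum of a `[0,1]`-matrix along a random permutation. -/
theorem tailProb_permSum_le {w : Fin n → Fin n → ℝ} (hw0 : ∀ i j, 0 ≤ w i j)
    (hw1 : ∀ i j, w i j ≤ 1) {L t : ℝ} (hL : 1 ≤ L) (ht : t ∈ Ioc (0 : ℝ) 1)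
    (hmean : (∑ i, ∑ j, w i j) / n ≤ L * t) {v : ℕ} (hv : 1 ≤ v) :
    tailProb (permSum w) (6 * L * v) ≤ t ^ v / (v.factorial : ℝ) := by
  obtain ⟨ht0, ht1⟩ := ht
  have hv1 : (1 : ℝ) ≤ v := by exact_mod_cast hv
  have hv0 : (0 : ℝ) < v := by linarith
  set s := v / t with hs
  have hs1 : 1 ≤ s := by rw [hs, le_div_iff₀ ht0]; linarith
  have hs0 : 0 < s := by linarith
  refine (tailProb_permSum_le_exp hw0 hw1 hs0.le _).trans ?_
  have hexp : Real.exp (Real.exp 1) ≤ (1 + s) ^ (5 : ℕ) := by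
    have h1 : Real.exp 1 ≤ 3 := by linarith [Real.exp_one_lt_d9]
    calc Real.exp (Real.exp 1) ≤ Real.exp (3 : ℕ) := Real.exp_le_exp.2 (by simpa using h1)
      _ = Real.exp 1 ^ 3 := by rw [← Real.exp_nat_mul]; simp
      _ ≤ 2.8 ^ 3 := by gcongr; linarith [Real.exp_one_lt_d9]
      _ ≤ 2 ^ 5 := by norm_num
      _ ≤ (1 + s) ^ 5 := by gcongr; linarith
  have hLv : 0 ≤ L * v := by positivity
  have h1 : Real.exp (Real.exp 1 * (s * ((∑ i, ∑ j, w i j) / n)))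
      ≤ (1 + s) ^ (5 * (L * v)) := by
    calc _ ≤ Real.exp (Real.exp 1 * (s * (L * t))) := by gcongr
      _ = Real.exp (Real.exp 1) ^ (L * v) := by
          rw [← Real.exp_mul]
          congr 2
          rw [hs]; field_simp
      _ ≤ ((1 + s) ^ (5 : ℕ)) ^ (L * v) := by gcongr
      _ = _ := by
          rw [← Real.rpow_natCast, ← Real.rpow_mul (by linarith)]
          norm_num
  calc (1 + s) ^ (-(6 * L * v)) * Real.exp (Real.exp 1 * (s * ((∑ i, ∑ j, w i j) / n)))
      ≤ (1 + s) ^ (-(6 * L * v)) * (1 + s) ^ (5 * (L * v)) := by gcongr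
    _ = (1 + s) ^ (-(L * v)) := by
        rw [← Real.rpow_add (by linarith)]; ring_nf
    _ ≤ s ^ (-(L * v)) :=
        Real.rpow_le_rpow_of_nonpos hs0 (by linarith) (by linarith)
    _ ≤ s ^ (-(v : ℝ)) := Real.rpow_le_rpow_of_exponent_le hs1 (by nlinarith)
    _ = t ^ v / (v : ℝ) ^ v := by
        rw [Real.rpow_neg hs0.le, Real.rpow_natCast, hs, div_pow, inv_div]
    _ ≤ _ := by
        gcongr
        exact_mod_cast Nat.factorial_le_pow v

theorem tailProb_permSum_mul_le {w : Fin n → Fin n → ℝ} (hw0 : ∀ i j, 0 ≤ w i j)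
    (hw1 : ∀ i j, w i j ≤ 1) {L t : ℝ} (hL : 1 ≤ L) (ht : t ∈ Ioc (0 : ℝ) 1)
    (hmean : (∑ i, ∑ j, w i j) / n ≤ L * t) (hzero : tailProb (permSum w) 0 ≤ t) (v : ℕ) :
    tailProb (permSum w) (12 * L * v) ≤ t ^ (v + 1) / ((v + 1).factorial : ℝ) := by
  rcases Nat.eq_zero_or_pos v with rfl | hv
  · simpa using hzero
  refine le_trans (tailProb_le_tailProb (t := 6 * L * (v + 1 : ℕ)) fun π hπ => ?_)
    (tailProb_permSum_le hw0 hw1 hL ht hmean (v := v + 1) (by omega))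
  refine lt_of_le_of_lt ?_ hπ
  have : (1 : ℝ) ≤ v := by exact_mod_cast hv
  push_cast
  nlinarith

theorem sum_permSum_sq_le (hn : 0 < n) {w : Fin n → Fin n → ℝ} {M : ℝ}
    (hw0 : ∀ i j, 0 ≤ w i j) (hwM : ∀ i j, w i j ≤ M) {lam : ℝ}
    (hlam : (∑ i, ∑ j, w i j) / n = lam) :
    ∑ π, permSum w π ^ 2 ≤ n.factorial * (M * lam + 2 * lam ^ 2) := by
  have hn' : (0 : ℝ) < n := by exact_mod_cast hn
  have hfac : (0 : ℝ) < n.factorial := by exact_mod_cast n.factorial_pos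
  have h1 : ∀ i i' : Fin n, ∑ π : Equiv.Perm (Fin n), w i (π i) * w i' (π i')
      ≤ (if i = i' then ∑ π : Equiv.Perm (Fin n), M * w i (π i) else 0)
        + 2 * n.factorial / (n : ℝ) ^ 2 * ((∑ j, w i j) * ∑ j, w i' j) := by
    intro i i'
    have hr : ∀ i, 0 ≤ ∑ j, w i j := fun i => Finset.sum_nonneg fun j _ => hw0 i j
    have hr' : 0 ≤ 2 * n.factorial / (n : ℝ) ^ 2 * ((∑ j, w i j) * ∑ j, w i' j) :=
      mul_nonneg (by positivity) (mul_nonneg (hr i) (hr i'))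
    split_ifs with h
    · subst h
      refine le_add_of_le_of_nonneg (Finset.sum_le_sum fun π _ => ?_) hr'
      exact mul_le_mul_of_nonneg_right (hwM _ _) (hw0 _ _)
    · have h2 := sum_perm_prod_le hw0 {i, i'}
      simp only [Finset.prod_pair h, Finset.card_pair h] at h2
      rw [zero_add]
      refine h2.trans (mul_le_mul_of_nonneg_right ?_ (mul_nonneg (hr i) (hr i')))
      have hn2 : 2 ≤ n := by
        have := Finset.card_le_univ ({i, i'} : Finset (Fin n))
        rwa [Finset.card_pair h, Fintype.card_fin] at this
      obtain ⟨m, rfl⟩ : ∃ m, n = m + 2 := ⟨n - 2, by omega⟩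
      rw [le_div_iff₀ (by positivity), Nat.add_sub_cancel, Nat.factorial_succ,
        Nat.factorial_succ]
      push_cast
      have hm : (0 : ℝ) < m.factorial := by exact_mod_cast m.factorial_pos
      have hm0 : (0 : ℝ) ≤ m := by positivity
      have : ((m : ℝ) + 2) ^ 2 ≤ 2 * ((m + 1 + 1) * (m + 1)) := by nlinarith
      nlinarith [mul_le_mul_of_nonneg_left this hm.le]
  have h2 : ∑ π, permSum w π ^ 2
      = ∑ i, ∑ i', ∑ π : Equiv.Perm (Fin n), w i (π i) * w i' (π i') := by
    simp_rw [permSum, sq, Finset.sum_mul_sum]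
    rw [Finset.sum_comm]
    exact Finset.sum_congr rfl fun i _ => Finset.sum_comm
  rw [h2]
  refine (Finset.sum_le_sum fun i _ => Finset.sum_le_sum fun i' _ => h1 i i').trans (le_of_eq ?_)
  simp_rw [Finset.sum_add_distrib, Finset.sum_ite_eq, Finset.mem_univ, if_true, ← Finset.mul_sum]
  have h3 := sum_permSum hn w
  unfold permSum at h3
  rw [Finset.sum_comm, hlam] at h3
  rw [h3]
  have h4 : ∑ i, ∑ j, w i j = n * lam := by rw [← hlam]; field_simp
  have h5 : ∑ i, ∑ i', (∑ j, w i j) * ∑ j, w i' j = (n * lam) ^ 2 := by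
    rw [← Finset.sum_mul_sum, h4, sq]
  simp_rw [← Finset.mul_sum] at h5 ⊢
  rw [h5]
  field_simp

/-- Paley–Zygmund inequality for the sum along a random permutation. -/
theorem le_tailProb_permSum (hn : 0 < n) {w : Fin n → Fin n → ℝ} {M : ℝ} (hM : 0 ≤ M)
    (hw0 : ∀ i j, 0 ≤ w i j) (hwM : ∀ i j, w i j ≤ M) {lam r : ℝ} (hlam0 : 0 < lam)
    (hlam : (∑ i, ∑ j, w i j) / n = lam) (hr : r ≤ lam / 2) :
    lam / (4 * (M + 2 * lam)) ≤ tailProb (permSum w) r := by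
  have hfac : (0 : ℝ) < n.factorial := by exact_mod_cast n.factorial_pos
  set A := Finset.univ.filter fun π => r < permSum w π with hA
  have h1 : n.factorial * lam ≤ ∑ π ∈ A, permSum w π + n.factorial * (lam / 2) := by
    have h := sum_permSum hn w
    rw [hlam] at h
    rw [← h, ← Finset.sum_filter_add_sum_filter_not Finset.univ (fun π => r < permSum w π)]
    gcongr
    calc _ ≤ ∑ π ∈ Finset.univ.filter (fun π => ¬ r < permSum w π), lam / 2 :=
          Finset.sum_le_sum fun π hπ => (not_lt.1 (Finset.mem_filter.1 hπ).2).trans hr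
      _ ≤ ∑ π : Equiv.Perm (Fin n), lam / 2 :=
          Finset.sum_le_sum_of_subset_of_nonneg (Finset.filter_subset _ _)
            fun _ _ _ => by positivity
      _ = _ := by simp [Fintype.card_perm]
  have h2 : (∑ π ∈ A, permSum w π) ^ 2 ≤ A.card * (n.factorial * (M * lam + 2 * lam ^ 2)) := by
    refine sq_sum_le_card_mul_sum_sq.trans ?_
    gcongr
    exact (Finset.sum_le_sum_of_subset_of_nonneg (Finset.filter_subset _ _)
      fun _ _ _ => sq_nonneg _).trans (sum_permSum_sq_le hn hw0 hwM hlam)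
  have h3 : (n.factorial * (lam / 2)) ^ 2 ≤ (∑ π ∈ A, permSum w π) ^ 2 := by
    have : (0 : ℝ) ≤ n.factorial * (lam / 2) := by positivity
    exact pow_le_pow_left₀ this (by linarith) 2
  rw [tailProb_perm, ← hA, div_le_div_iff₀ (by positivity) hfac]
  have h4 := h3.trans h2
  have h5 : (n.factorial * lam) * (lam * n.factorial)
      ≤ (n.factorial * lam) * (A.card * (4 * (M + 2 * lam))) := by nlinarith
  exact le_of_mul_le_mul_left h5 (by positivity)

section FixedPoints

variable (A : Finset (Fin n))

/-- The number of fixed points of a permutation in `A`. -/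
def fixedIn (π : Equiv.Perm (Fin n)) : ℕ := (A.filter fun i => π i = i).card

theorem tailProb_fixedIn_le (v : ℕ) :
    tailProb (fun π => (fixedIn A π : ℝ)) v
      ≤ ((A.card : ℝ) / n) ^ (v + 1) / ((v + 1).factorial : ℝ) := by
  have hfac : (0 : ℝ) < n.factorial := by exact_mod_cast n.factorial_pos
  have hcard : A.card ≤ n := by simpa using Finset.card_le_univ A
  set j := v + 1 with hj
  have h1 : (Finset.univ.filter fun π : Equiv.Perm (Fin n) => (v : ℝ) < fixedIn A π).card
      ≤ A.card.choose j * (n - j).factorial := by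
    rw [← Finset.card_powersetCard]
    refine le_trans (Finset.card_le_card (t := (A.powersetCard j).biUnion fun J =>
      Finset.univ.filter fun π : Equiv.Perm (Fin n) => ∀ i ∈ J, π i = i) fun π hπ => ?_) ?_
    · have h : v < fixedIn A π := by exact_mod_cast (Finset.mem_filter.1 hπ).2
      obtain ⟨J, hJ, hJc⟩ := Finset.exists_subset_card_eq (n := j) (s := A.filter fun i => π i = i) h
      refine Finset.mem_biUnion.2 ⟨J, Finset.mem_powersetCard.2
        ⟨hJ.trans (Finset.filter_subset _ _), hJc⟩, Finset.mem_filter.2 ⟨Finset.mem_univ _, ?_⟩⟩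
      exact fun i hi => (Finset.mem_filter.1 (hJ hi)).2
    · refine Finset.card_biUnion_le_card_mul _ _ _ fun J hJ => ?_
      have := card_perm_eqOn_le J fun i => i
      rwa [(Finset.mem_powersetCard.1 hJ).2] at this
  rw [tailProb_perm, div_le_iff₀ hfac]
  refine (Nat.cast_le.2 h1).trans ?_
  rcases lt_or_ge A.card j with hlt | hle
  · rw [Nat.choose_eq_zero_of_lt hlt]
    simp only [zero_mul, Nat.cast_zero]
    positivity
  have hdesc : ∀ j, n ^ j * A.card.descFactorial j ≤ A.card ^ j * n.descFactorial j := by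
    intro j
    induction j with
    | zero => simp
    | succ j ih =>
      rw [Nat.descFactorial_succ, Nat.descFactorial_succ, pow_succ, pow_succ]
      have : n * (A.card - j) ≤ A.card * (n - j) := by
        rw [Nat.mul_sub, Nat.mul_sub, mul_comm n A.card]
        exact Nat.sub_le_sub_left (Nat.mul_le_mul_right _ hcard) _
      calc _ = (n * (A.card - j)) * (n ^ j * A.card.descFactorial j) := by ring
        _ ≤ (A.card * (n - j)) * (A.card ^ j * n.descFactorial j) := Nat.mul_le_mul this ih
        _ = _ := by ring
  have hn : (0 : ℝ) < n := by exact_mod_cast (by omega : 0 < n)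
  have hjf : (0 : ℝ) < j.factorial := by exact_mod_cast j.factorial_pos
  have e1 : (A.card.descFactorial j : ℝ) = j.factorial * A.card.choose j := by
    exact_mod_cast Nat.descFactorial_eq_factorial_mul_choose _ _
  have e2 : ((n - j).factorial : ℝ) * n.descFactorial j = n.factorial := by
    exact_mod_cast Nat.factorial_mul_descFactorial (hle.trans hcard)
  have e3 : (n : ℝ) ^ j * A.card.descFactorial j ≤ (A.card : ℝ) ^ j * n.descFactorial j := by
    exact_mod_cast hdesc j
  rw [div_pow, div_div, div_mul_eq_mul_div, le_div_iff₀ (by positivity), ← e2]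
  rw [e1] at e3
  push_cast
  have hnj : (0 : ℝ) ≤ (n - j).factorial := by positivity
  nlinarith [mul_le_mul_of_nonneg_left e3 hnj]

theorem le_tailProb_fixedIn (v : ℕ) :
    ((A.card.choose (v + 1) * numDerangements (n - (v + 1)) : ℕ) : ℝ) / n.factorial
      ≤ tailProb (fun π => (fixedIn A π : ℝ)) v := by
  rw [tailProb_perm]
  gcongr
  set j := v + 1 with hj
  have hcardJ : ∀ J ∈ A.powersetCard j, (Finset.univ.filter fun π : Equiv.Perm (Fin n) =>
      ∀ i, i ∈ J ↔ π i = i).card = numDerangements (n - j) := by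
    intro J hJ
    have h := Fintype.card_congr (derangements.subtypeEquiv fun a : Fin n => a ∉ J)
    rw [card_derangements_eq_numDerangements, Fintype.card_subtype_compl, Fintype.card_fin,
      Fintype.card_coe, (Finset.mem_powersetCard.1 hJ).2] at h
    rw [h, Fintype.card_subtype]
    congr 1
    ext π
    simp [Function.mem_fixedPoints, Function.IsFixedPt]
  calc A.card.choose j * numDerangements (n - j)
      = ((A.powersetCard j).biUnion fun J => Finset.univ.filter fun π : Equiv.Perm (Fin n) =>
          ∀ i, i ∈ J ↔ π i = i).card := by
        rw [Finset.card_biUnion, Finset.sum_congr rfl hcardJ, Finset.sum_const,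
          Finset.card_powersetCard, smul_eq_mul]
        intro J _ K _ hne
        refine Finset.disjoint_left.2 ?_
        intro π h1 h2
        refine hne (Finset.ext fun i => ?_)
        exact ((Finset.mem_filter.1 h1).2 i).trans ((Finset.mem_filter.1 h2).2 i).symm
    _ ≤ _ := by
        refine Finset.card_le_card fun π hπ => ?_
        obtain ⟨J, hJ, hπJ⟩ := Finset.mem_biUnion.1 hπ
        obtain ⟨hJA, hJc⟩ := Finset.mem_powersetCard.1 hJ
        refine Finset.mem_filter.2 ⟨Finset.mem_univ _, ?_⟩
        have : J ⊆ A.filter fun i => π i = i := fun i hi =>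
          Finset.mem_filter.2 ⟨hJA hi, ((Finset.mem_filter.1 hπJ).2 i).1 hi⟩
        have := Finset.card_le_card this
        have : v < fixedIn A π := by unfold fixedIn; omega
        exact_mod_cast this

end FixedPoints

end Perm

theorem sum_rpow_sub_one_le {ι : Type*} (A : Finset ι) {c : ι → ℝ} (hc : ∀ i, 0 ≤ c i) {q : ℝ}
    (hq : 1 ≤ q) :
    ∑ i ∈ A, c i ^ (q - 1) ≤ (A.card : ℝ) ^ (1 / q) * (∑ i ∈ A, c i ^ q) ^ (1 - 1 / q) := by
  rcases hq.eq_or_lt with rfl | hq1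
  · simp
  have hconj : q.HolderConjugate (q / (q - 1)) := Real.HolderConjugate.conjExponent hq1
  have h := Real.inner_le_Lp_mul_Lq A (fun _ => 1) (fun i => c i ^ (q - 1)) hconj
  have hq0 : q - 1 ≠ 0 := by linarith
  have h1 : ∀ i ∈ A, |c i ^ (q - 1)| ^ (q / (q - 1)) = c i ^ q := fun i _ => by
    rw [abs_of_nonneg (Real.rpow_nonneg (hc i) _), ← Real.rpow_mul (hc i)]
    congr 1
    field_simp
  have h2 : 1 / (q / (q - 1)) = 1 - 1 / q := by
    have : q ≠ 0 := by linarith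
    field_simp
  rw [Finset.sum_congr rfl h1, h2] at h
  simpa using h

/-- The embedding of the Lorentz space `ℓ_{q,1}` into `ℓ_q`, with constant one. -/
theorem ofReal_lpNorm_le_lintegral_card {ι : Type*} [Fintype ι] {a : ι → ℝ} (ha : ∀ i, 0 ≤ a i)
    {q : ℝ} (hq : 1 ≤ q) :
    ENNReal.ofReal ((∑ i, a i ^ q) ^ (1 / q)) ≤ ∫⁻ s in Ioi (0 : ℝ),
      ENNReal.ofReal (((Finset.univ.filter fun i => s < a i).card : ℝ) ^ (1 / q)) := by
  have hq0 : 0 < q := by linarith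
  have hnn : ∀ i, 0 ≤ a i ^ q := fun i => Real.rpow_nonneg (ha i) _
  have hS0 : 0 ≤ ∑ i, a i ^ q := Finset.sum_nonneg fun i _ => hnn i
  set S := ∑ i, a i ^ q with hS
  rcases hS0.eq_or_lt with h0 | hpos
  · rw [← h0, Real.zero_rpow (one_div_pos.2 hq0).ne']
    simp
  have h1 : ENNReal.ofReal S ≤ ENNReal.ofReal (S ^ (1 - 1 / q)) * ∫⁻ s in Ioi (0 : ℝ),
      ENNReal.ofReal (((Finset.univ.filter fun i => s < a i).card : ℝ) ^ (1 / q)) := by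
    calc ENNReal.ofReal S = ∑ i, ENNReal.ofReal (a i ^ (q - 1)) * ENNReal.ofReal (a i) := by
          rw [hS, ENNReal.ofReal_sum_of_nonneg fun i _ => hnn i]
          refine Finset.sum_congr rfl fun i _ => ?_
          rw [← ENNReal.ofReal_mul (Real.rpow_nonneg (ha i) _)]
          congr 1
          rcases (ha i).eq_or_lt with h | h
          · rw [← h, mul_zero, Real.zero_rpow hq0.ne']
          · rw [Real.rpow_sub_one h.ne', div_mul_cancel₀ _ h.ne']
      _ = ∫⁻ s in Ioi (0 : ℝ), ENNReal.ofReal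
            (∑ i ∈ Finset.univ.filter fun i => s < a i, a i ^ (q - 1)) := by
          simp_rw [← lintegral_ite_lt (a _), ← lintegral_const_mul _ (measurable_ite_lt _)]
          rw [← lintegral_finsetSum _ fun r _ => (measurable_ite_lt _).const_mul _]
          refine lintegral_congr fun s => ?_
          rw [ENNReal.ofReal_sum_of_nonneg fun i _ => Real.rpow_nonneg (ha i) _,
            Finset.sum_filter]
          refine Finset.sum_congr rfl fun r _ => ?_
          split_ifs <;> simp
      _ ≤ ∫⁻ s in Ioi (0 : ℝ), ENNReal.ofReal (S ^ (1 - 1 / q)) *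
            ENNReal.ofReal (((Finset.univ.filter fun i => s < a i).card : ℝ) ^ (1 / q)) := by
          refine lintegral_mono fun s => ?_
          dsimp only
          rw [← ENNReal.ofReal_mul (by positivity), mul_comm]
          refine ENNReal.ofReal_le_ofReal ((sum_rpow_sub_one_le _ ha hq).trans ?_)
          have : 0 ≤ 1 - 1 / q := by
            rw [sub_nonneg, div_le_one hq0]; exact hq
          have h2 : ∑ i ∈ Finset.univ.filter (fun i => s < a i), a i ^ q ≤ S :=
            Finset.sum_le_sum_of_subset_of_nonneg (Finset.filter_subset _ _) fun i _ _ => hnn i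
          have h3 : 0 ≤ ∑ i ∈ Finset.univ.filter (fun i => s < a i), a i ^ q :=
            Finset.sum_nonneg fun i _ => hnn i
          gcongr
      _ = _ := lintegral_const_mul' _ _ ENNReal.ofReal_ne_top
  have h2 : S ^ (1 / q) = S ^ (-(1 - 1 / q)) * S := by
    nth_rewrite 3 [← Real.rpow_one S]
    rw [← Real.rpow_add hpos]
    ring_nf
  have h3 : S ^ (-(1 - 1 / q)) * S ^ (1 - 1 / q) = 1 := by
    rw [← Real.rpow_add hpos, neg_add_cancel, Real.rpow_zero]
  rw [h2, ENNReal.ofReal_mul (by positivity)]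
  refine (mul_le_mul_right h1 _).trans ?_
  rw [← mul_assoc, ← ENNReal.ofReal_mul (by positivity), h3, ENNReal.ofReal_one, one_mul]

section Layers

variable {n : ℕ}

theorem levelNorm_diagonalNorm_le_lintegral (φ : PhiClass) {q : ℝ} (hq : 1 ≤ q)
    (x : Matrix (Fin n) (Fin n) ℝ) :
    levelNorm φ (diagonalNorm q x) ≤ ∫⁻ s in Ioi (0 : ℝ), levelNorm φ
      fun π : Equiv.Perm (Fin n) =>
        ((Finset.univ.filter fun i => s < |x i (π i)|).card : ℝ) ^ (1 / q) := by
  obtain ⟨e, he⟩ := exists_antitone_comp_equiv (diagonalNorm q x)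
  rw [← orderedSum_eq_levelNorm φ he]
  refine le_trans ?_ (lintegral_mono fun s => orderedSum_le_levelNorm φ e _)
  unfold orderedSum
  have hmeas : ∀ π : Equiv.Perm (Fin n), Measurable fun s : ℝ => ENNReal.ofReal
      (((Finset.univ.filter fun i => s < |x i (π i)|).card : ℝ) ^ (1 / q)) := by
    intro π
    refine Antitone.measurable fun s t hst => ENNReal.ofReal_le_ofReal ?_
    have h1 : (Finset.univ.filter fun i => t < |x i (π i)|).card
        ≤ (Finset.univ.filter fun i => s < |x i (π i)|).card :=
      Finset.card_le_card (Finset.monotone_filter_right _ fun i _ hi => hst.trans_lt hi)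
    gcongr
  rw [lintegral_finsetSum _ fun r _ => (hmeas _).const_mul _]
  refine Finset.sum_le_sum fun r _ => ?_
  rw [lintegral_const_mul _ (hmeas _)]
  gcongr
  exact ofReal_lpNorm_le_lintegral_card (fun i => abs_nonneg _) hq

theorem levelNorm_zero_rpow (φ : PhiClass) {q : ℝ} (hq : 1 ≤ q) {Z : Equiv.Perm (Fin n) → ℝ}
    (hZ : ∀ π, Z π = 0) : levelNorm φ (fun π => Z π ^ (1 / q)) = 0 := by
  have hq' : 1 / q ≠ 0 := (one_div_pos.2 (by linarith)).ne'
  simp_rw [hZ, Real.zero_rpow hq']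
  exact levelNorm_zero φ

theorem card_div_mem_Ioc {k : ℕ} (hk : 0 < k) (hkn : k ≤ n) : (k : ℝ) / n ∈ Ioc (0 : ℝ) 1 := by
  have h1 : (0 : ℝ) < k := by exact_mod_cast hk
  have h2 : (k : ℝ) ≤ n := by exact_mod_cast hkn
  exact ⟨div_pos h1 (by linarith), (div_le_one (by linarith)).2 h2⟩

theorem levelNorm_fixedIn_le (φ : PhiClass) {q : ℝ} (hq : 1 ≤ q) (A : Finset (Fin n)) :
    levelNorm φ (fun π => (fixedIn A π : ℝ) ^ (1 / q))
      ≤ gammaConst φ q * ENNReal.ofReal (φ ((A.card : ℝ) / n)) := by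
  rcases Nat.eq_zero_or_pos A.card with h0 | hpos
  · rw [levelNorm_zero_rpow φ hq fun π => ?_]
    · exact zero_le
    · rw [Finset.card_eq_zero.1 h0]; simp [fixedIn]
  have hcard : A.card ≤ n := by simpa using Finset.card_le_univ A
  have := levelNorm_rpow_le_gammaConst φ hq (Z := fun π => (fixedIn A π : ℝ))
    (fun π => by positivity) one_pos (card_div_mem_Ioc hpos hcard)
    (fun v => by rw [one_mul]; exact tailProb_fixedIn_le A v)
  simpa using this

theorem measurable_level (φ : PhiClass) {Ω : Type*} [Fintype Ω] (g : Ω → ℝ) :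
    Measurable fun s : ℝ => ENNReal.ofReal (φ (tailProb g s)) := by
  refine Antitone.measurable fun s t hst => ENNReal.ofReal_le_ofReal ?_
  exact φ.mono (tailProb_nonneg _ _) (tailProb_le_tailProb fun ω h => hst.trans_lt h)
    (tailProb_le_one _ _)

theorem levelNorm_diagonal_le (φ : PhiClass) {q : ℝ} (hq : 1 ≤ q) (y : Fin n → ℝ) :
    levelNorm φ (diagonalNorm q (Matrix.diagonal y))
      ≤ gammaConst φ q * levelNorm φ fun i => |y i| := by
  refine (levelNorm_diagonalNorm_le_lintegral φ hq _).trans ?_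
  rw [levelNorm.eq_def _ fun i => |y i|, ← lintegral_const_mul _ (measurable_level φ _)]
  refine setLIntegral_mono' measurableSet_Ioi fun s hs => ?_
  have hs : 0 < s := hs
  refine le_trans (le_of_eq ?_)
    ((levelNorm_fixedIn_le φ hq (Finset.univ.filter fun i => s < |y i|)).trans_eq ?_)
  · congr 1
    ext π
    congr 2
    rw [fixedIn, Finset.filter_filter]
    congr 1
    ext i
    simp only [Finset.mem_filter, Finset.mem_univ, true_and]
    by_cases h : π i = i
    · simp [h]
    · simp [Matrix.diagonal_apply_ne _ (Ne.symm h), h, hs.le]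
  · rw [tailProb, Fintype.card_fin]

/-- The indicator matrix of a set of cells. -/
def cellMatrix (B : Finset (Fin n × Fin n)) (i j : Fin n) : ℝ := if (i, j) ∈ B then 1 else 0

theorem cellMatrix_nonneg (B : Finset (Fin n × Fin n)) (i j : Fin n) : 0 ≤ cellMatrix B i j := by
  unfold cellMatrix; split_ifs <;> norm_num

theorem cellMatrix_le_one (B : Finset (Fin n × Fin n)) (i j : Fin n) : cellMatrix B i j ≤ 1 := by
  unfold cellMatrix; split_ifs <;> norm_num

theorem sum_cellMatrix (B : Finset (Fin n × Fin n)) : ∑ i, ∑ j, cellMatrix B i j = B.card := by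
  rw [← Fintype.sum_prod_type']
  simp [cellMatrix]

theorem permSum_cellMatrix (B : Finset (Fin n × Fin n)) (π : Equiv.Perm (Fin n)) :
    permSum (cellMatrix B) π = (Finset.univ.filter fun i => (i, π i) ∈ B).card := by
  simp [permSum, cellMatrix]

theorem tailProb_permSum_cellMatrix_zero_le (B : Finset (Fin n × Fin n)) (hn : 0 < n) :
    tailProb (permSum (cellMatrix B)) 0 ≤ B.card / n := by
  have hfac : (0 : ℝ) < n.factorial := by exact_mod_cast n.factorial_pos
  rw [tailProb_perm, div_le_iff₀ hfac, mul_comm, ← sum_cellMatrix, ← sum_permSum hn,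
    Finset.card_filter, Nat.cast_sum]
  refine Finset.sum_le_sum fun π _ => ?_
  rw [permSum_cellMatrix]
  split_ifs with h
  · exact Nat.cast_le.2 (by exact_mod_cast h)
  · simp

theorem levelNorm_cells_le (φ : PhiClass) {q : ℝ} (hq : 1 ≤ q) (B : Finset (Fin n × Fin n))
    (hB : B.card ≤ n) :
    levelNorm φ (fun π => permSum (cellMatrix B) π ^ (1 / q))
      ≤ 12 * (gammaConst φ q * ENNReal.ofReal (φ ((B.card : ℝ) / n))) := by
  rcases Nat.eq_zero_or_pos B.card with h0 | hpos
  · rw [levelNorm_zero_rpow φ hq fun π => ?_]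
    · exact zero_le
    · rw [Finset.card_eq_zero.1 h0]; simp [permSum, cellMatrix]
  refine (levelNorm_rpow_le_gammaConst φ hq (permSum_nonneg (cellMatrix_nonneg B))
    (K := 12 * 1) (by norm_num) (card_div_mem_Ioc hpos hB) fun v => ?_).trans ?_
  · refine tailProb_permSum_mul_le (cellMatrix_nonneg B) (cellMatrix_le_one B) le_rfl
      (card_div_mem_Ioc hpos hB) ?_ (tailProb_permSum_cellMatrix_zero_le B (by omega)) v
    rw [sum_cellMatrix, one_mul]
  · gcongr
    rw [mul_one]
    calc ENNReal.ofReal (12 ^ (1 / q)) ≤ ENNReal.ofReal (12 ^ (1 : ℝ)) := by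
          refine ENNReal.ofReal_le_ofReal
            (Real.rpow_le_rpow_of_exponent_le (by norm_num) ?_)
          rw [div_le_one (by linarith)]; exact hq
      _ = 12 := by simp

theorem le_tailProb_cells (hn : 0 < n) (B : Finset (Fin n × Fin n)) (hB : B.card ≤ n) :
    1 / 12 * ((B.card : ℝ) / n) ≤ tailProb (permSum (cellMatrix B)) 0 := by
  rcases Nat.eq_zero_or_pos B.card with h0 | hpos
  · rw [h0]; simpa using tailProb_nonneg _ _
  obtain ⟨ht0, ht1⟩ := card_div_mem_Ioc hpos hB
  refine le_trans ?_ (le_tailProb_permSum hn zero_le_one (cellMatrix_nonneg B)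
    (cellMatrix_le_one B) ht0 (by rw [sum_cellMatrix]) (by positivity))
  rw [le_div_iff₀ (by positivity)]
  nlinarith

end Layers

section Equivalence

variable {n : ℕ}

theorem diagonalNorm_eq_rpow_permSum (q : ℝ) (x : Matrix (Fin n) (Fin n) ℝ)
    (π : Equiv.Perm (Fin n)) :
    diagonalNorm q x π = permSum (fun i j => |x i j| ^ q) π ^ (1 / q) := rfl

theorem abs_le_diagonalNorm {q : ℝ} (hq : 0 < q) (x : Matrix (Fin n) (Fin n) ℝ)
    (π : Equiv.Perm (Fin n)) (i : Fin n) : |x i (π i)| ≤ diagonalNorm q x π := by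
  have h1 : |x i (π i)| ^ q ≤ ∑ i, |x i (π i)| ^ q :=
    Finset.single_le_sum (f := fun i => |x i (π i)| ^ q) (fun i _ => by positivity)
      (Finset.mem_univ i)
  calc |x i (π i)| = (|x i (π i)| ^ q) ^ (1 / q) := by
        rw [← Real.rpow_mul (abs_nonneg _), mul_one_div_cancel hq.ne', Real.rpow_one]
    _ ≤ _ := by unfold diagonalNorm; gcongr

theorem measurable_card_gt (φ : PhiClass) (x : Matrix (Fin n) (Fin n) ℝ) :
    Measurable fun s : ℝ => ENNReal.ofReal
      (φ ((min n (Finset.univ.filter fun p : Fin n × Fin n => s < |x p.1 p.2|).card : ℕ) / n)) := by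
  refine Antitone.measurable fun s t hst => ENNReal.ofReal_le_ofReal ?_
  have h := Finset.card_le_card (Finset.monotone_filter_right
    (Finset.univ : Finset (Fin n × Fin n)) (p := fun p => t < |x p.1 p.2|)
    (q := fun p => s < |x p.1 p.2|) fun p _ hp => hst.trans_lt hp)
  refine φ.mono (by positivity) ?_
    (div_le_one_of_le₀ (Nat.cast_le.2 (min_le_left _ _)) (by positivity))
  gcongr

theorem lorentzNorm_opU_le_levelNorm (φ : PhiClass) {q : ℝ} (hq : 1 ≤ q) (hn : 0 < n)
    (x : Matrix (Fin n) (Fin n) ℝ) :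
    lorentzNorm φ (opU x) ≤ 12 * levelNorm φ (diagonalNorm q x) := by
  rw [lorentzNorm_opU, levelNorm, ← lintegral_const_mul _ (measurable_level φ _)]
  refine setLIntegral_mono' measurableSet_Ioi fun s hs => ?_
  set B' := Finset.univ.filter fun p : Fin n × Fin n => s < |x p.1 p.2| with hB'
  obtain ⟨B, hBB', hBc⟩ := Finset.exists_subset_card_eq (min_le_right n B'.card)
  have hBn : B.card ≤ n := hBc ▸ min_le_left _ _
  rw [← hBc]
  have h1 : tailProb (permSum (cellMatrix B)) 0 ≤ tailProb (diagonalNorm q x) s := by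
    refine tailProb_le_tailProb fun π hπ => ?_
    rw [permSum_cellMatrix, Nat.cast_pos, Finset.card_pos] at hπ
    obtain ⟨i, hi⟩ := hπ
    have := (Finset.mem_filter.1 (hBB' (Finset.mem_filter.1 hi).2)).2
    exact this.trans_le (abs_le_diagonalNorm (by linarith) x π i)
  have ht1 : (B.card : ℝ) / n ≤ 1 := div_le_one_of_le₀ (Nat.cast_le.2 hBn) (by positivity)
  have h2 := φ.mul_le (c := 1 / 12) (by norm_num) (by norm_num)
    (show (0 : ℝ) ≤ B.card / n by positivity) ht1
  have h3 := φ.mono (by positivity) ((le_tailProb_cells hn B hBn).trans h1)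
    (tailProb_le_one _ _)
  calc ENNReal.ofReal (φ ((B.card : ℝ) / n))
      ≤ ENNReal.ofReal (12 * φ (tailProb (diagonalNorm q x) s)) :=
        ENNReal.ofReal_le_ofReal (by linarith)
    _ = _ := by rw [ENNReal.ofReal_mul (by norm_num)]; simp

theorem mean_min_rpow {q : ℝ} (hq : 0 < q) (hn : 0 < n) (x : Matrix (Fin n) (Fin n) ℝ) :
    (∑ i, ∑ j, min |x i j| (entryRearrangement x n) ^ q) / n
      = entryRearrangement x n ^ q + tailTerm q x ^ q := by
  have hn' : (n : ℝ) ≠ 0 := by exact_mod_cast hn.ne'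
  rw [← Fintype.sum_prod_type' fun i j => min |x i j| (entryRearrangement x n) ^ q,
    sum_min_rpow_eq, tailTerm_rpow x hq]
  field_simp

theorem tailTerm_le_levelNorm (φ : PhiClass) {q : ℝ} (hq : 1 ≤ q) (hn : 0 < n)
    (x : Matrix (Fin n) (Fin n) ℝ) :
    ENNReal.ofReal (tailTerm q x) ≤ 24 * levelNorm φ (diagonalNorm q x) := by
  have hq0 : 0 < q := by linarith
  have hτ := tailTerm_nonneg x q
  have hm := entryRearrangement_nonneg x n
  set m := entryRearrangement x n with hmdef
  set τ := tailTerm q x with hτdef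
  rcases hτ.eq_or_lt with h0 | hτpos
  · rw [← h0]; simp
  have hmq : 0 ≤ m ^ q := by positivity
  have hτq : 0 < τ ^ q := by positivity
  have hlam : 0 < m ^ q + τ ^ q := by linarith
  set w : Fin n → Fin n → ℝ := fun i j => min |x i j| m ^ q with hw
  have hmin : ∀ i j, 0 ≤ min |x i j| m := fun i j => le_min (abs_nonneg _) hm
  have hlevel : ∀ s : ℝ, s < τ / 2 →
      1 / 12 ≤ φ (tailProb (diagonalNorm q x) s) := by
    intro s hs
    have h1 : tailProb (permSum w) ((τ / 2) ^ q) ≤ tailProb (diagonalNorm q x) s := by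
      refine tailProb_le_tailProb fun π hπ => hs.trans ?_
      have h2 : permSum w π ≤ permSum (fun i j => |x i j| ^ q) π :=
        Finset.sum_le_sum fun i _ =>
          Real.rpow_le_rpow (hmin i _) (min_le_left _ _) hq0.le
      rw [diagonalNorm_eq_rpow_permSum]
      calc τ / 2 = ((τ / 2) ^ q) ^ (1 / q) := by
            rw [← Real.rpow_mul (by positivity), mul_one_div_cancel hq0.ne', Real.rpow_one]
        _ < _ := Real.rpow_lt_rpow (by positivity) (hπ.trans_le h2) (by positivity)
    have hr : (τ / 2) ^ q ≤ (m ^ q + τ ^ q) / 2 := by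
      have h3 : (1 / 2 : ℝ) ^ q ≤ 1 / 2 := by
        simpa using Real.rpow_le_rpow_of_exponent_ge (x := 1 / 2) (by norm_num) (by norm_num) hq
      have h4 : (τ / 2) ^ q = τ ^ q * (1 / 2) ^ q := by
        rw [← Real.mul_rpow hτ (by norm_num), mul_one_div]
      rw [h4]
      nlinarith
    have h2 := le_tailProb_permSum hn hmq (w := w) (fun i j => Real.rpow_nonneg (hmin i j) _)
      (fun i j => Real.rpow_le_rpow (hmin i j) (min_le_right _ _) hq0.le) hlam
      (mean_min_rpow hq0 hn x) hr
    have h3 : 1 / 12 ≤ (m ^ q + τ ^ q) / (4 * (m ^ q + 2 * (m ^ q + τ ^ q))) := by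
      rw [div_le_div_iff₀ (by norm_num) (by positivity)]
      linarith
    exact (h3.trans (h2.trans h1)).trans (φ.le_self (tailProb_nonneg _ _) (tailProb_le_one _ _))
  have h5 : ENNReal.ofReal (1 / 12) * ENNReal.ofReal (τ / 2)
      ≤ levelNorm φ (diagonalNorm q x) := by
    rw [levelNorm, ← lintegral_ite_lt (τ / 2), ← lintegral_const_mul _ (measurable_ite_lt _)]
    refine lintegral_mono fun s => ?_
    dsimp only
    split_ifs with h
    · rw [mul_one]; exact ENNReal.ofReal_le_ofReal (hlevel s h)
    · simp
  calc ENNReal.ofReal τ = 24 * (ENNReal.ofReal (1 / 12) * ENNReal.ofReal (τ / 2)) := by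
        rw [← ENNReal.ofReal_mul (by norm_num), ← ENNReal.ofReal_ofNat,
          ← ENNReal.ofReal_mul (by norm_num)]
        congr 1
        ring
    _ ≤ _ := by gcongr

theorem levelNorm_large_part_le (φ : PhiClass) {q : ℝ} (hq : 1 ≤ q) (hn : 0 < n)
    (x : Matrix (Fin n) (Fin n) ℝ) :
    levelNorm φ (diagonalNorm q fun i j => |x i j| - min |x i j| (entryRearrangement x n))
      ≤ 12 * gammaConst φ q * lorentzNorm φ (opU x) := by
  have hm := entryRearrangement_nonneg x n
  refine (levelNorm_diagonalNorm_le_lintegral φ hq _).trans ?_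
  rw [lorentzNorm_opU, ← lintegral_const_mul _ (measurable_card_gt φ x)]
  refine setLIntegral_mono' measurableSet_Ioi fun s hs => ?_
  have hs : 0 < s := hs
  set m := entryRearrangement x n with hmdef
  have hlt : ∀ i j, s < |(|x i j| - min |x i j| m)| → s + m < |x i j| := by
    intro i j h
    rw [abs_of_nonneg (sub_nonneg.2 (min_le_left _ _))] at h
    rcases le_total |x i j| m with h' | h'
    · rw [min_eq_left h'] at h; linarith
    · rw [min_eq_right h'] at h; linarith
  set B := Finset.univ.filter fun p : Fin n × Fin n =>
    s < |(|x p.1 p.2| - min |x p.1 p.2| m)| with hB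
  have hBn : B.card ≤ n := by
    refine le_trans (Finset.card_le_card ?_) (card_gt_entryRearrangement_lt x hn).le
    exact Finset.monotone_filter_right _ fun p _ hp => by have := hlt _ _ hp; linarith
  have hBs : B.card ≤ (Finset.univ.filter fun p : Fin n × Fin n => s < |x p.1 p.2|).card :=
    Finset.card_le_card
      (Finset.monotone_filter_right _ fun p _ hp => by have := hlt _ _ hp; linarith)
  refine le_trans (le_of_eq ?_) ((levelNorm_cells_le φ hq B hBn).trans ?_)
  · congr 1
    ext π
    rw [permSum_cellMatrix]
    simp [hB]
  · rw [mul_assoc]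
    gcongr
    refine φ.mono (by positivity) ?_
      (div_le_one_of_le₀ (Nat.cast_le.2 (min_le_left _ _)) (by positivity))
    gcongr
    exact le_min hBn hBs

theorem levelNorm_small_part_le (φ : PhiClass) {q : ℝ} (hq : 1 ≤ q) (hn : 0 < n)
    (x : Matrix (Fin n) (Fin n) ℝ) :
    levelNorm φ (diagonalNorm q fun i j => min |x i j| (entryRearrangement x n))
      ≤ 12 * gammaConst φ q * (ENNReal.ofReal (entryRearrangement x n)
        + ENNReal.ofReal (tailTerm q x)) := by
  have hq0 : 0 < q := by linarith
  have ha0 : 0 ≤ 1 / q := by positivity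
  have ha1 : 1 / q ≤ 1 := by rw [div_le_one hq0]; exact hq
  have hτ := tailTerm_nonneg x q
  have hmean := mean_min_rpow hq0 hn x
  have hm := entryRearrangement_nonneg x n
  set m := entryRearrangement x n with hmdef
  set τ := tailTerm q x with hτdef
  have hmin : ∀ i j, 0 ≤ min |x i j| m := fun i j => le_min (abs_nonneg _) hm
  rcases hm.eq_or_lt with h0 | hmpos
  · refine le_trans (le_of_eq ?_) zero_le
    refine levelNorm_zero_rpow φ hq (Z := fun π => ∑ i, |min |x i (π i)| m| ^ q) fun π => ?_
    refine Finset.sum_eq_zero fun i _ => ?_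
    rw [← h0, min_eq_right (abs_nonneg _), abs_zero, Real.zero_rpow hq0.ne']
  have hmq : 0 < m ^ q := by positivity
  have hτq : 0 ≤ τ ^ q := by positivity
  set w : Fin n → Fin n → ℝ := fun i j => (min |x i j| m / m) ^ q with hw
  set L := (m ^ q + τ ^ q) / m ^ q with hL
  have hL1 : 1 ≤ L := by rw [hL, le_div_iff₀ hmq]; linarith
  have hw0 : ∀ i j, 0 ≤ w i j := fun i j => Real.rpow_nonneg (div_nonneg (hmin i j) hm) _
  have hw1 : ∀ i j, w i j ≤ 1 := fun i j => Real.rpow_le_one (div_nonneg (hmin i j) hm)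
    ((div_le_one hmpos).2 (min_le_right _ _)) hq0.le
  have hwmean : (∑ i, ∑ j, w i j) / n ≤ L * 1 := by
    have : ∑ i, ∑ j, w i j = (∑ i, ∑ j, min |x i j| m ^ q) / m ^ q := by
      rw [Finset.sum_div]
      refine Finset.sum_congr rfl fun i _ => ?_
      rw [Finset.sum_div]
      exact Finset.sum_congr rfl fun j _ => Real.div_rpow (hmin i j) hm q
    rw [this, mul_one, hL, ← hmean, div_right_comm]
  have heq : (diagonalNorm q fun i j => min |x i j| m)
      = fun π => m * permSum w π ^ (1 / q) := by
    ext π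
    have h1 : permSum (fun i j => |min |x i j| m| ^ q) π = m ^ q * permSum w π := by
      rw [permSum, permSum, Finset.mul_sum]
      refine Finset.sum_congr rfl fun i _ => ?_
      rw [hw, abs_of_nonneg (hmin _ _), ← Real.mul_rpow hm (div_nonneg (hmin _ _) hm),
        mul_div_cancel₀ _ hmpos.ne']
    change permSum (fun i j => |min |x i j| m| ^ q) π ^ (1 / q) = _
    rw [h1, Real.mul_rpow hmq.le (permSum_nonneg hw0 π),
      ← Real.rpow_mul hm, mul_one_div_cancel hq0.ne', Real.rpow_one]
  have h1 := levelNorm_rpow_le_gammaConst φ hq (permSum_nonneg hw0) (K := 12 * L) (t := 1)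
    (by linarith) ⟨one_pos, le_rfl⟩
    (tailProb_permSum_mul_le hw0 hw1 hL1 ⟨one_pos, le_rfl⟩ hwmean (tailProb_le_one _ _))
  rw [φ.map_one', ENNReal.ofReal_one, mul_one] at h1
  have h2 : m * (12 * L) ^ (1 / q) ≤ 12 * (m + τ) := by
    have e1 : m * (12 * L) ^ (1 / q) = 12 ^ (1 / q) * (m ^ q + τ ^ q) ^ (1 / q) := by
      have : m = (m ^ q) ^ (1 / q) := by
        rw [← Real.rpow_mul hm, mul_one_div_cancel hq0.ne', Real.rpow_one]
      nth_rewrite 1 [this]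
      rw [← Real.mul_rpow hmq.le (by linarith), ← Real.mul_rpow (by norm_num) (by linarith), hL]
      congr 1
      field_simp
    have e2 : (m ^ q + τ ^ q) ^ (1 / q) ≤ m + τ := by
      have := Real.rpow_le_rpow (by linarith) (Real.add_rpow_le_rpow_add hm hτ hq) ha0
      rwa [← Real.rpow_mul (by linarith), mul_one_div_cancel hq0.ne', Real.rpow_one] at this
    have e3 : (12 : ℝ) ^ (1 / q) ≤ 12 := by
      simpa using Real.rpow_le_rpow_of_exponent_le (x := 12) (by norm_num) ha1
    rw [e1]
    exact mul_le_mul e3 e2 (by positivity) (by norm_num)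
  rw [heq, levelNorm_const_mul φ hm]
  calc _ ≤ ENNReal.ofReal m * (ENNReal.ofReal ((12 * L) ^ (1 / q)) * gammaConst φ q) := by gcongr
    _ = ENNReal.ofReal (m * (12 * L) ^ (1 / q)) * gammaConst φ q := by
        rw [← mul_assoc, ← ENNReal.ofReal_mul hm]
    _ ≤ ENNReal.ofReal (12 * (m + τ)) * gammaConst φ q := by gcongr
    _ = _ := by
        rw [ENNReal.ofReal_mul (by norm_num), ENNReal.ofReal_add hm hτ, ENNReal.ofReal_ofNat]
        ring

theorem levelNorm_diagonalNorm_le (φ : PhiClass) {q : ℝ} (hq : 1 ≤ q) (hn : 0 < n)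
    (x : Matrix (Fin n) (Fin n) ℝ) :
    levelNorm φ (diagonalNorm q x) ≤ 24 * gammaConst φ q *
      (lorentzNorm φ (opU x) + ENNReal.ofReal (tailTerm q x)) := by
  set m := entryRearrangement x n with hmdef
  have hsplit : ∀ π, diagonalNorm q x π
      ≤ ((diagonalNorm q fun i j => |x i j| - min |x i j| m)
        + diagonalNorm q fun i j => min |x i j| m) π := by
    intro π
    have h := Real.Lp_add_le Finset.univ (fun i => |x i (π i)| - min |x i (π i)| m)
      (fun i => min |x i (π i)| m) hq
    simp only [sub_add_cancel, abs_abs] at h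
    exact h
  refine (levelNorm_mono φ hsplit).trans ((levelNorm_add_le φ _ _).trans ?_)
  refine (add_le_add (levelNorm_large_part_le φ hq hn x)
    (levelNorm_small_part_le φ hq hn x)).trans ?_
  have hU := ofReal_entryRearrangement_le_lorentzNorm_opU x φ hn
  set U := lorentzNorm φ (opU x)
  set T := ENNReal.ofReal (tailTerm q x)
  calc _ ≤ 12 * gammaConst φ q * U + 12 * gammaConst φ q * (U + T) := by gcongr
    _ ≤ 12 * gammaConst φ q * (U + T) + 12 * gammaConst φ q * (U + T) := by
        gcongr
        exact le_self_add
    _ = _ := by ring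

end Equivalence

theorem opTNorm_le_gammaConst (φ : PhiClass) {q : ℝ} (hq : 1 ≤ q)
    (ℓ : ∀ n : ℕ, Equiv.Perm (Fin n) ≃ Fin n.factorial) :
    opTNorm φ q ℓ ≤ gammaConst φ q := by
  refine sInf_le fun n _ y => ?_
  rw [lorentzNorm_opT, lorentzNorm_opU_diagonal]
  exact levelNorm_diagonal_le φ hq y

open Filter Topology in
theorem tendsto_poisson_lower_bound {t : ℝ} (ht : 0 ≤ t) (j : ℕ) :
    Tendsto (fun n : ℕ => ((⌊t * n⌋₊ + 1 - j : ℕ) / (n : ℝ)) ^ j / (j.factorial : ℝ) *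
        (numDerangements (n - j) / ((n - j).factorial : ℝ))) atTop
      (𝓝 (t ^ j / (j.factorial : ℝ) * Real.exp (-1))) := by
  have h1 : Tendsto (fun n : ℕ => (⌊t * n⌋₊ : ℝ) / (n : ℝ)) atTop (𝓝 t) :=
    (tendsto_nat_floor_mul_div_atTop ht).comp tendsto_natCast_atTop_atTop
  have h2 : Tendsto (fun n : ℕ => ((⌊t * n⌋₊ + 1 - j : ℕ) : ℝ) / (n : ℝ)) atTop (𝓝 t) := by
    have h3 : ∀ c : ℝ, Tendsto (fun n : ℕ => c / (n : ℝ)) atTop (𝓝 0) := fun c =>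
      tendsto_const_div_atTop_nhds_zero_nat c
    have hlow := h1.sub (h3 j)
    have hupp := h1.add (h3 1)
    rw [sub_zero] at hlow
    rw [add_zero] at hupp
    refine tendsto_of_tendsto_of_tendsto_of_le_of_le hlow hupp (fun n => ?_) fun n => ?_
    · dsimp only
      rw [← sub_div]
      gcongr
      rw [sub_le_iff_le_add]
      exact_mod_cast (by omega : ⌊t * n⌋₊ ≤ ⌊t * n⌋₊ + 1 - j + j)
    · dsimp only
      rw [← add_div]
      gcongr
      exact_mod_cast (by omega : ⌊t * n⌋₊ + 1 - j ≤ ⌊t * n⌋₊ + 1)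
  exact ((h2.pow j).div_const _).mul
    (numDerangements_tendsto_inv_e.comp (tendsto_sub_atTop_nat j))

theorem poisson_lower_bound_le_tailProb {n : ℕ} (A : Finset (Fin n)) (v : ℕ) :
    ((A.card + 1 - (v + 1) : ℕ) / (n : ℝ)) ^ (v + 1) / ((v + 1).factorial : ℝ) *
        (numDerangements (n - (v + 1)) / ((n - (v + 1)).factorial : ℝ))
      ≤ tailProb (fun π => (fixedIn A π : ℝ)) v := by
  have hcard : A.card ≤ n := by simpa using Finset.card_le_univ A
  refine le_trans ?_ (le_tailProb_fixedIn A v)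
  set j := v + 1 with hj
  rcases lt_or_ge A.card j with hlt | hle
  · rw [show A.card + 1 - j = 0 by omega, hj]
    simp only [Nat.cast_zero, zero_div, zero_pow (Nat.succ_ne_zero v), zero_mul]
    positivity
  have hn : (0 : ℝ) < n := by exact_mod_cast (by omega : 0 < n)
  have hjf : (0 : ℝ) < j.factorial := by exact_mod_cast j.factorial_pos
  have hnj : (0 : ℝ) < (n - j).factorial := by exact_mod_cast (n - j).factorial_pos
  have e1 : (((A.card + 1 - j : ℕ) : ℝ)) ^ j ≤ j.factorial * A.card.choose j := by
    have := Nat.pow_sub_le_descFactorial A.card j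
    rw [Nat.descFactorial_eq_factorial_mul_choose] at this
    exact_mod_cast this
  have e2 : (n.factorial : ℝ) ≤ (n - j).factorial * (n : ℝ) ^ j := by
    rw [← Nat.factorial_mul_descFactorial (hle.trans hcard)]
    exact_mod_cast Nat.mul_le_mul_left _ (Nat.descFactorial_le_pow n j)
  have hfac : (0 : ℝ) < n.factorial := by exact_mod_cast n.factorial_pos
  have e3 : (n.factorial : ℝ) * (((A.card + 1 - j : ℕ) : ℝ)) ^ j
      ≤ ((n - j).factorial * (n : ℝ) ^ j) * (j.factorial * A.card.choose j) :=
    mul_le_mul e2 e1 (by positivity) (by positivity)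
  rw [div_pow, div_div, div_mul_div_comm, div_le_div_iff₀ (by positivity) hfac]
  push_cast
  have hD : (0 : ℝ) ≤ numDerangements (n - j) := by positivity
  nlinarith [mul_le_mul_of_nonneg_left e3 hD]

/-- The norm inequality on the indicator of the first `k` diagonal entries. -/
theorem sum_le_of_diagonal_bound (φ : PhiClass) {q : ℝ} (hq : 1 ≤ q) {n k : ℕ} (hk : k ≤ n)
    {C : ℝ≥0} (hC : ∀ y : Fin n → ℝ, levelNorm φ (diagonalNorm q (Matrix.diagonal y))
      ≤ C * levelNorm φ fun i => |y i|) (J : ℕ) :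
    ∑ v ∈ Finset.range J, (((v + 1 : ℕ) : ℝ) ^ (1 / q) - (v : ℝ) ^ (1 / q)) *
        φ (tailProb (fun π => (fixedIn (Finset.univ.filter fun i : Fin n => (i : ℕ) < k) π : ℝ)) v)
      ≤ C * φ ((k : ℝ) / n) := by
  have hq0 : 0 < q := by linarith
  set A := Finset.univ.filter fun i : Fin n => (i : ℕ) < k with hA
  have hAk : A.card = k := by
    rw [hA, Fin.card_filter_val_lt, min_eq_right hk]
  have hδ : ∀ v : ℕ, 0 ≤ ((v + 1 : ℕ) : ℝ) ^ (1 / q) - (v : ℝ) ^ (1 / q) := fun v =>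
    sub_nonneg.2 (by gcongr; simp)
  have h := hC fun i => if (-k : ℝ) < -(i : ℕ) then 1 else 0
  have hU : (levelNorm φ fun i : Fin n => |if (-k : ℝ) < -(i : ℕ) then (1 : ℝ) else 0|)
      = ENNReal.ofReal (φ ((k : ℝ) / n)) := by
    have : (fun i : Fin n => |if (-k : ℝ) < -(i : ℕ) then (1 : ℝ) else 0|)
        = fun i : Fin n => if (-k : ℝ) < -(i : ℕ) then 1 else 0 := by
      ext i; split_ifs <;> simp
    rw [this, levelNorm_indicator φ (fun i : Fin n => -((i : ℕ) : ℝ)) (-k), tailProb,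
      Fintype.card_fin]
    simp only [neg_lt_neg_iff, Nat.cast_lt]
    rw [← hA, hAk]
  have hT : diagonalNorm q (Matrix.diagonal fun i : Fin n =>
      if (-k : ℝ) < -(i : ℕ) then (1 : ℝ) else 0) = fun π => (fixedIn A π : ℝ) ^ (1 / q) := by
    ext π
    have h1 : ∀ i, |Matrix.diagonal (fun i : Fin n =>
        if (-k : ℝ) < -(i : ℕ) then (1 : ℝ) else 0) i (π i)| ^ q
        = if (i : ℕ) < k ∧ π i = i then 1 else 0 := by
      intro i
      by_cases hi : π i = i
      · simp only [hi, Matrix.diagonal_apply_eq, neg_lt_neg_iff, Nat.cast_lt, and_true]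
        split_ifs <;> simp [hq0.ne']
      · rw [Matrix.diagonal_apply_ne _ (Ne.symm hi), abs_zero, Real.zero_rpow hq0.ne']
        simp [hi]
    rw [diagonalNorm, Finset.sum_congr rfl fun i _ => h1 i, fixedIn, hA, Finset.filter_filter]
    simp
  rw [hU, hT] at h
  have h2 := levelNorm_ge_sum_indicator φ (Finset.range J) (fun π => (fixedIn A π : ℝ))
    (fun π => (fixedIn A π : ℝ) ^ (1 / q))
    (fun v => ((v + 1 : ℕ) : ℝ) ^ (1 / q) - (v : ℝ) ^ (1 / q)) (fun v => (v : ℝ))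
    (fun v _ => hδ v) fun π => ?_
  · have h3 := h2.trans h
    have hk1 : (k : ℝ) / n ≤ 1 := div_le_one_of_le₀ (Nat.cast_le.2 hk) (by positivity)
    have hφ := φ.nonneg (show (0 : ℝ) ≤ k / n by positivity) hk1
    have hp : ∀ v : ℕ, 0 ≤ φ (tailProb (fun π => (fixedIn A π : ℝ)) v) := fun v =>
      φ.nonneg (tailProb_nonneg _ _) (tailProb_le_one _ _)
    simp_rw [← ENNReal.ofReal_mul (hδ _)] at h3
    rw [← ENNReal.ofReal_sum_of_nonneg fun v _ => mul_nonneg (hδ v) (hp v),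
      ← ENNReal.ofReal_coe_nnreal, ← ENNReal.ofReal_mul C.coe_nonneg] at h3
    exact (ENNReal.ofReal_le_ofReal_iff (mul_nonneg C.coe_nonneg hφ)).1 h3
  · set Y := fixedIn A π
    have hpos : 1 / q ≠ 0 := (one_div_pos.2 hq0).ne'
    calc _ ≤ ∑ v ∈ Finset.range J ∪ Finset.range Y,
          (((v + 1 : ℕ) : ℝ) ^ (1 / q) - (v : ℝ) ^ (1 / q)) *
            (if (v : ℝ) < (Y : ℝ) then 1 else 0) := by
          refine Finset.sum_le_sum_of_subset_of_nonneg Finset.subset_union_left fun v _ _ => ?_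
          have := hδ v
          positivity
      _ = ∑ v ∈ Finset.range Y, (((v + 1 : ℕ) : ℝ) ^ (1 / q) - (v : ℝ) ^ (1 / q)) := by
          symm
          refine Finset.sum_subset_zero_on_sdiff Finset.subset_union_right (fun v hv => ?_)
            fun v hv => ?_
          · have : ¬ (v : ℝ) < (Y : ℝ) := by
              simpa using (Finset.mem_sdiff.1 hv).2
            rw [if_neg this, mul_zero]
          · rw [if_pos (by exact_mod_cast Finset.mem_range.1 hv), mul_one]
      _ = (Y : ℝ) ^ (1 / q) := by
          rw [Finset.sum_range_sub (fun v : ℕ => (v : ℝ) ^ (1 / q))]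
          rw [Nat.cast_zero, Real.zero_rpow hpos, sub_zero]

open Filter Topology in
theorem sum_gamma_le_of_diagonal_bound (φ : PhiClass) {q : ℝ} (hq : 1 ≤ q) {C : ℝ≥0}
    (hC : ∀ n : ℕ, 0 < n → ∀ y : Fin n → ℝ,
      levelNorm φ (diagonalNorm q (Matrix.diagonal y)) ≤ C * levelNorm φ fun i => |y i|)
    {t : ℝ} (ht : t ∈ Ioc (0 : ℝ) 1) (J : ℕ) :
    ∑ v ∈ Finset.range J, ((v + 1 : ℕ) : ℝ) ^ (1 / q - 1) *
        φ (t ^ (v + 1) / ((v + 1).factorial : ℝ))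
      ≤ q * Real.exp 1 * (C * φ t) := by
  obtain ⟨ht0, ht1⟩ := ht
  have hq0 : 0 < q := by linarith
  have ha0 : 0 ≤ 1 / q := by positivity
  have ha1 : 1 / q ≤ 1 := by rw [div_le_one hq0]; exact hq
  have hδ : ∀ v : ℕ, 0 ≤ ((v + 1 : ℕ) : ℝ) ^ (1 / q) - (v : ℝ) ^ (1 / q) := fun v =>
    sub_nonneg.2 (by gcongr; simp)
  have hx : ∀ v : ℕ, 0 < t ^ (v + 1) / ((v + 1).factorial : ℝ) ∧
      t ^ (v + 1) / ((v + 1).factorial : ℝ) ≤ 1 := fun v => by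
    have : (0 : ℝ) < (v + 1).factorial := by exact_mod_cast Nat.factorial_pos _
    refine ⟨by positivity, div_le_one_of_le₀ ((pow_le_one₀ ht0.le ht1).trans ?_) this.le⟩
    exact_mod_cast Nat.factorial_pos _
  have he0 : 0 < Real.exp (-1) := Real.exp_pos _
  have he1 : Real.exp (-1) ≤ 1 := by rw [Real.exp_le_one_iff]; norm_num
  have hee : Real.exp 1 * Real.exp (-1) = 1 := by rw [← Real.exp_add]; simp
  set s : ℕ → ℕ → ℝ := fun v n =>
    ((⌊t * n⌋₊ + 1 - (v + 1) : ℕ) / (n : ℝ)) ^ (v + 1) / ((v + 1).factorial : ℝ) *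
      (numDerangements (n - (v + 1)) / ((n - (v + 1)).factorial : ℝ)) with hs
  have hfloor : ∀ n : ℕ, ⌊t * n⌋₊ ≤ n := fun n => by
    refine Nat.floor_le_of_le ?_
    have : (0 : ℝ) ≤ n := by positivity
    nlinarith
  have hsp : ∀ v n, s v n ≤ tailProb (fun π : Equiv.Perm (Fin n) =>
      (fixedIn (Finset.univ.filter fun i : Fin n => (i : ℕ) < ⌊t * n⌋₊) π : ℝ)) v := by
    intro v n
    have := poisson_lower_bound_le_tailProb
      (Finset.univ.filter fun i : Fin n => (i : ℕ) < ⌊t * n⌋₊) v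
    rwa [Fin.card_filter_val_lt, min_eq_right (hfloor n)] at this
  have hs0 : ∀ v n, 0 ≤ s v n := fun v n => by positivity
  have hlim : ∀ v, Tendsto (fun n => φ (s v n)) atTop
      (𝓝 (φ (t ^ (v + 1) / ((v + 1).factorial : ℝ) * Real.exp (-1)))) := by
    intro v
    have h1 := tendsto_poisson_lower_bound ht0.le (v + 1)
    have hl0 : 0 < t ^ (v + 1) / ((v + 1).factorial : ℝ) * Real.exp (-1) := mul_pos (hx v).1 he0
    have hl1 : t ^ (v + 1) / ((v + 1).factorial : ℝ) * Real.exp (-1) ≤ 1 :=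
      mul_le_one₀ (hx v).2 he0.le he1
    refine (φ.continuousOn' _ ⟨hl0, hl1⟩).tendsto.comp
      (tendsto_nhdsWithin_iff.2 ⟨h1, ?_⟩)
    filter_upwards [h1.eventually (lt_mem_nhds hl0)] with n hn
    exact ⟨hn, (hsp v n).trans (tailProb_le_one _ _)⟩
  have hmain : ∑ v ∈ Finset.range J, (((v + 1 : ℕ) : ℝ) ^ (1 / q) - (v : ℝ) ^ (1 / q)) *
      φ (t ^ (v + 1) / ((v + 1).factorial : ℝ) * Real.exp (-1)) ≤ C * φ t := by
    refine le_of_tendsto (tendsto_finsetSum _ fun v _ => (hlim v).const_mul _) ?_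
    filter_upwards [eventually_gt_atTop 0] with n hn
    refine le_trans (Finset.sum_le_sum fun v _ => mul_le_mul_of_nonneg_left
      (φ.mono (hs0 v n) (hsp v n) (tailProb_le_one _ _)) (hδ v))
      ((sum_le_of_diagonal_bound φ hq (hfloor n) (hC n hn) J).trans ?_)
    have hn' : (0 : ℝ) < n := by exact_mod_cast hn
    refine mul_le_mul_of_nonneg_left (φ.mono (by positivity) ?_ ht1) C.coe_nonneg
    rw [div_le_iff₀ hn']
    exact Nat.floor_le (by positivity)
  refine le_trans ?_ (mul_le_mul_of_nonneg_left hmain (by positivity))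
  rw [Finset.mul_sum]
  refine Finset.sum_le_sum fun v _ => ?_
  have h1 := mul_rpow_sub_one_le_sub ha0 ha1 v
  have h2 := φ.mul_le he0.le he1 (hx v).1.le (hx v).2
  rw [mul_comm (Real.exp (-1)) (_ / _)] at h2
  have hφ0 := φ.nonneg (hx v).1.le (hx v).2
  set X := φ (t ^ (v + 1) / ((v + 1).factorial : ℝ))
  set P := ((v + 1 : ℕ) : ℝ) ^ (1 / q - 1) with hP
  have hP0 : 0 ≤ P := by positivity
  calc P * X = q * Real.exp 1 * ((1 / q * P) * (Real.exp (-1) * X)) := by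
        have : q * (1 / q) = 1 := mul_one_div_cancel hq0.ne'
        calc P * X = (q * (1 / q)) * (Real.exp 1 * Real.exp (-1)) * (P * X) := by
              rw [this, hee]; ring
          _ = _ := by ring
    _ ≤ _ := by
        have := hδ v
        gcongr

theorem gammaConst_le_opTNorm (φ : PhiClass) {q : ℝ} (hq : 1 ≤ q)
    (ℓ : ∀ n : ℕ, Equiv.Perm (Fin n) ≃ Fin n.factorial) :
    gammaConst φ q ≤ ENNReal.ofReal (q * Real.exp 1) * opTNorm φ q ℓ := by
  have hqe : 0 < q * Real.exp 1 := mul_pos (by linarith) (Real.exp_pos 1)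
  have hne : ENNReal.ofReal (q * Real.exp 1) ≠ 0 := (ENNReal.ofReal_pos.2 hqe).ne'
  rw [mul_comm, ← ENNReal.div_le_iff hne ENNReal.ofReal_ne_top]
  refine le_sInf fun C hC => ?_
  rw [ENNReal.div_le_iff hne ENNReal.ofReal_ne_top]
  rcases eq_or_ne C ⊤ with rfl | hCtop
  · rw [ENNReal.top_mul hne]; exact le_top
  lift C to ℝ≥0 using hCtop
  have hC' : ∀ n : ℕ, 0 < n → ∀ y : Fin n → ℝ,
      levelNorm φ (diagonalNorm q (Matrix.diagonal y)) ≤ C * levelNorm φ fun i => |y i| := by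
    intro n hn y
    have := hC n hn y
    rwa [lorentzNorm_opT, lorentzNorm_opU_diagonal] at this
  refine iSup₂_le fun t ht => ?_
  have hp := φ.pos ht.1 ht.2
  have hsum : ∑' j : ℕ+, ENNReal.ofReal
      (((j : ℕ) : ℝ) ^ (1 / q - 1) * φ (t ^ (j : ℕ) / ((j : ℕ).factorial : ℝ)))
      ≤ ENNReal.ofReal (q * Real.exp 1 * (C * φ t)) := by
    rw [← Equiv.pnatEquivNat.symm.tsum_eq]
    refine ENNReal.tsum_le_of_sum_range_le fun J => ?_
    rw [← ENNReal.ofReal_sum_of_nonneg]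
    · refine ENNReal.ofReal_le_ofReal ?_
      simpa only [Equiv.pnatEquivNat_symm_apply, Nat.succPNat_coe, Nat.succ_eq_add_one]
        using sum_gamma_le_of_diagonal_bound φ hq hC' ht J
    · intro v _
      refine mul_nonneg (by positivity) (φ.nonneg (div_nonneg (pow_nonneg ht.1.le _)
        (by positivity)) (div_le_one_of_le₀ ((pow_le_one₀ ht.1.le ht.2).trans ?_)
        (by positivity)))
      exact_mod_cast Nat.factorial_pos _
  calc _ ≤ ENNReal.ofReal (1 / φ t) * ENNReal.ofReal (q * Real.exp 1 * (C * φ t)) := by gcongr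
    _ = ENNReal.ofReal (C * (q * Real.exp 1)) := by
        rw [← ENNReal.ofReal_mul (by positivity)]
        congr 1
        field_simp
    _ = _ := by
        rw [ENNReal.ofReal_mul C.coe_nonneg, ENNReal.ofReal_coe_nnreal]

theorem equivalenceHolds_of_gammaConst_lt_top (φ : PhiClass) {q : ℝ} (hq : 1 ≤ q)
    (ℓ : ∀ n : ℕ, Equiv.Perm (Fin n) ≃ Fin n.factorial) (hΓ : gammaConst φ q < ⊤) :
    EquivalenceHolds φ q ℓ := by
  lift gammaConst φ q to ℝ≥0 using hΓ.ne with G hG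
  refine ⟨1 / 36, 24 * G + 1, by norm_num, by positivity, fun n hn x => ?_⟩
  rw [lorentzNorm_opT]
  constructor
  · have h := add_le_add (lorentzNorm_opU_le_levelNorm φ hq hn x)
      (tailTerm_le_levelNorm φ hq hn x)
    calc _ ≤ ((1 / 36 : ℝ≥0) : ℝ≥0∞) * (12 * levelNorm φ (diagonalNorm q x)
          + 24 * levelNorm φ (diagonalNorm q x)) := by gcongr
      _ = (((1 / 36 : ℝ≥0) * 36 : ℝ≥0) : ℝ≥0∞) * levelNorm φ (diagonalNorm q x) := by
          push_cast; ring
      _ = _ := by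
          rw [one_div_mul_cancel (by norm_num)]; simp
  · refine (levelNorm_diagonalNorm_le φ hq hn x).trans ?_
    rw [← hG]
    gcongr
    push_cast
    exact le_self_add

theorem opTNorm_lt_top_of_equivalenceHolds (φ : PhiClass) {q : ℝ} (hq : 1 ≤ q)
    (ℓ : ∀ n : ℕ, Equiv.Perm (Fin n) ≃ Fin n.factorial) (h : EquivalenceHolds φ q ℓ) :
    opTNorm φ q ℓ < ⊤ := by
  obtain ⟨c, C, -, -, H⟩ := h
  refine lt_of_le_of_lt (sInf_le (a := (C : ℝ≥0∞)) fun n hn y => ?_) ENNReal.coe_lt_top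
  have := (H n hn (Matrix.diagonal y)).2
  rwa [tailTerm_diagonal y (by linarith), ENNReal.ofReal_zero, add_zero] at this

theorem theorem10 (φ : PhiClass) (q : ℝ) (hq : 1 ≤ q)
    (ℓ : ∀ n : ℕ, Equiv.Perm (Fin n) ≃ Fin n.factorial) :
    (EquivalenceHolds φ q ℓ ↔ gammaConst φ q < ⊤) ∧
      opTNorm φ q ℓ ≤ gammaConst φ q ∧
      gammaConst φ q ≤ ENNReal.ofReal (q * Real.exp 1) * opTNorm φ q ℓ :=
  ⟨⟨fun h => (gammaConst_le_opTNorm φ hq ℓ).trans_lt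
      (ENNReal.mul_lt_top ENNReal.ofReal_lt_top (opTNorm_lt_top_of_equivalenceHolds φ hq ℓ h)),
    equivalenceHolds_of_gammaConst_lt_top φ hq ℓ⟩,
    opTNorm_le_gammaConst φ hq ℓ, gammaConst_le_opTNorm φ hq ℓ⟩
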